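/- Let $F_n$ be the free group on $A=\{a_1,\dots,a_n\}$ ($n\ge 0$), whose elements are identified with the reduced words over $A^{\pm}=A\sqcup A^{-1}$. For a subgroup $H\le F_n$ let $$\mathrm{Coc}_\oplus(H)=\{u\in F_n : \langle H\cup\{u\}\rangle=F_n \text{ and } H\cap\langle u\rangle=\{1\}\}$$ be the set of $\oplus$-cocycles of $H$, and let $\mathcal C_n\subseteq F_n$ be the set of elements whose reduced word is cyclically reduced (that is, empty or with first and last letters not mutually inverse). If $H$ is finitely generated, then $\mathrm{Coc}_\oplus(H)\cap\mathcal C_n$ is a rational subset of $F_n$, that is, it can be obtained from the empty set and singletons by finitely many unions, products and stars (generated submonoids). Moreover, a finite automaton recognizing this set is effectively computable: there is an algorithm which, given $n$ and a finite list of words over $A^{\pm}$ generating a subgroup $H\le F_n$, outputs a finite automaton over the alphabet $A^{\pm}$ whose language is exactly the set of reduced words representing the elements of $\mathrm{Coc}_\oplus(H)\cap\mathcal C_n$. -/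

import Mathlib

open scoped Pointwise

/-- Rational subsets of a monoid: the smallest family of subsets containing the empty set and the
singletons and closed under union, product and star (generated submonoid). -/
inductive IsRationalSubset {M : Type*} [Monoid M] : Set M → Prop
  | empty : IsRationalSubset ∅
  | singleton (x : M) : IsRationalSubset {x}
  | union {S T : Set M} : IsRationalSubset S → IsRationalSubset T → IsRationalSubset (S ∪ T)
  | mul {S T : Set M} : IsRationalSubset S → IsRationalSubset T → IsRationalSubset (S * T)
  | star {S : Set M} : IsRationalSubset S → IsRationalSubset (Submonoid.closure S : Set M)

/-- The `⊕`-cocycles of `H`: the elements `u` with `H ∨ ⟨u⟩ = G` and `H ∩ ⟨u⟩ = 1`. -/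
def directCocycles {G : Type*} [Group G] (H : Subgroup G) : Set G :=
  {u | H ⊔ Subgroup.zpowers u = ⊤ ∧ H ⊓ Subgroup.zpowers u = ⊥}

/-- The elements of the free group of rank `n` whose reduced word is cyclically reduced. -/
def cyclicallyReducedElements (n : ℕ) : Set (FreeGroup (Fin n)) :=
  {u | FreeGroup.IsCyclicallyReduced u.toWord}

/-- The subgroup generated by the elements that the words in a list represent. -/
def generatedSubgroup {n : ℕ} (gens : List (List (Fin n × Bool))) : Subgroup (FreeGroup (Fin n)) :=
  Subgroup.closure {g | ∃ w ∈ gens, FreeGroup.mk w = g}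

/-- A concrete description of a finite (nondeterministic) automaton: the number `m` of states, the
states being `0, …, m - 1`, the lists of initial and of final states, and the list of arcs
`(source, label, target)`. The label `(i, true)` is the `i`-th letter of the alphabet and
`(i, false)` its formal inverse. -/
structure FiniteAutomaton where
  numStates : ℕ
  initial : List ℕ
  final : List ℕ
  arcs : List (ℕ × (ℕ × Bool) × ℕ)

namespace FiniteAutomaton

/-- A finite automaton is a tuple of natural numbers and lists. -/
def equivTuple : FiniteAutomaton ≃ ℕ × List ℕ × List ℕ × List (ℕ × (ℕ × Bool) × ℕ) where
  toFun M := (M.numStates, M.initial, M.final, M.arcs)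
  invFun t := ⟨t.1, t.2.1, t.2.2.1, t.2.2.2⟩
  left_inv _ := rfl
  right_inv _ := rfl

instance : Primcodable FiniteAutomaton := Primcodable.ofEquiv _ equivTuple

/-- The automaton over the involutive alphabet on `n` letters that `M` describes (entries that do
not refer to an existing state or letter play no role). -/
def toNFA (M : FiniteAutomaton) (n : ℕ) : NFA (Fin n × Bool) (Fin M.numStates) where
  step p x := {q | ((p : ℕ), ((x.1 : ℕ), x.2), (q : ℕ)) ∈ M.arcs}
  start := {p | (p : ℕ) ∈ M.initial}
  accept := {p | (p : ℕ) ∈ M.final}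

end FiniteAutomaton

/-- Words over the involutive alphabet on `n` letters, written with the numbers of the letters, as
the input of an algorithm that takes `n` as an argument. -/
def rawWords {n : ℕ} (gens : List (List (Fin n × Bool))) : List (List (ℕ × Bool)) :=
  gens.map (List.map fun x => ((x.1 : ℕ), x.2))

/-! Let `A` be a finite part of the Schreier graph of `H` in which every reduced word of `H` labels
a loop at the base point `o`; the cosets of the prefixes of the generators give one. Cut from a
reduced word `u` its longest prefix readable from `o`, and from the rest its longest suffix readable
into `o`. If at least two letters remain in the middle, they can be attached to `A` as a new path.
The resulting finite inverse automaton extends to a permutation action in which `H` and `u` fix the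
base point while the whole group does not, so `H` and `u` do not generate
(`IsSchreierPart.sup_zpowers_ne_top`). Otherwise at most one letter `y` remains, and whether `H` and
`u` generate depends only on `y` and the two states that it joins
(`IsSchreierPart.sup_zpowers_eq_top_iff`).

If `u` is cyclically reduced, its powers are reduced as written, so `u ^ k` lies in `H` exactly when
it labels a loop at `o`. The condition on the intersection is therefore governed by the partial map
of states that `u` induces. Altogether a finite profile of a word determines its left quotient
(`IsSchreierPart.mem_cocycleWords_of_profile_eq`): the language is regular, with an explicit bound
`m` on the number of left quotients.

The bound also makes the automaton computable. Words of length at most `m ^ 2` represent all left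
quotients and separate them, so it suffices to decide membership of words in the language
(`NFA.accepts_eq_of_shortWords`). This reduces to membership in finitely generated subgroups,
decided by two parallel searches: for a product of generators and inverses, or for a separating
permutation action (`exists_computable_mem_rawSubgroup`). Rationality in the group follows by
Kleene's argument (`NFA.isRationalSubset_image`). -/

/-- A partial action of the free group on `α` by partial injections of `Q`: a deterministic
automaton over the involutive alphabet on `α` whose arcs can be traversed backwards. -/
structure InverseAutomaton (α Q : Type*) where
  step : Q → α × Bool → Option Q
  step_not : ∀ {p q : Q} {a : α} {b : Bool}, step p (a, b) = some q → step q (a, !b) = some p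

/-! ### Inverse automata and their extension to permutation actions -/

namespace InverseAutomaton

variable {α Q : Type*} (A : InverseAutomaton α Q)

/-- The state reached by reading a word. -/
def run : Q → List (α × Bool) → Option Q
  | q, [] => some q
  | q, x :: w => (A.step q x).bind fun r => run r w

@[simp] theorem run_nil (q : Q) : A.run q [] = some q := rfl

theorem run_cons (q : Q) (x : α × Bool) (w : List (α × Bool)) :
    A.run q (x :: w) = (A.step q x).bind fun r => A.run r w := rfl

theorem run_append (q : Q) (u v : List (α × Bool)) :
    A.run q (u ++ v) = (A.run q u).bind fun r => A.run r v := by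
  induction u generalizing q with
  | nil => rfl
  | cons x u ih =>
    simp only [List.cons_append, run_cons, Option.bind_assoc]
    congr 1; funext r; exact ih r

theorem run_append_eq_some {q r : Q} {u v : List (α × Bool)} :
    A.run q (u ++ v) = some r ↔ ∃ m, A.run q u = some m ∧ A.run m v = some r := by
  rw [run_append, Option.bind_eq_some_iff]

theorem run_cons_eq_some {q r : Q} {x : α × Bool} {v : List (α × Bool)} :
    A.run q (x :: v) = some r ↔ ∃ m, A.step q x = some m ∧ A.run m v = some r := by
  rw [run_cons, Option.bind_eq_some_iff]

@[simp] theorem run_singleton (q : Q) (x : α × Bool) : A.run q [x] = A.step q x := by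
  simp [run_cons]

theorem step_not_iff {p q : Q} {a : α} {b : Bool} :
    A.step p (a, !b) = some q ↔ A.step q (a, b) = some p :=
  ⟨fun h => by simpa using A.step_not h, A.step_not⟩

theorem run_invRev {p q : Q} {w : List (α × Bool)} (h : A.run p w = some q) :
    A.run q (FreeGroup.invRev w) = some p := by
  induction w generalizing p with
  | nil => simpa [eq_comm] using h
  | cons x w ih =>
    obtain ⟨m, hm, hw⟩ := A.run_cons_eq_some.1 h
    rw [FreeGroup.invRev_cons, run_append_eq_some]
    refine ⟨m, ih hw, ?_⟩
    obtain ⟨a, b⟩ := x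
    simpa [FreeGroup.invRev] using A.step_not hm

/-- Crossing an arc and then its inverse returns to the same state, so a cancelling pair can be
dropped from a run. The converse fails, as the arc may be missing. -/
theorem run_of_redStep {p q : Q} {u v : List (α × Bool)} (h : FreeGroup.Red.Step u v)
    (hu : A.run p u = some q) : A.run p v = some q := by
  obtain ⟨⟩ := h
  rename_i l r a b
  obtain ⟨m, hm, h1⟩ := A.run_append_eq_some.1 hu
  obtain ⟨m', hm', h2⟩ := A.run_cons_eq_some.1 h1
  obtain ⟨m'', hm'', h3⟩ := A.run_cons_eq_some.1 h2
  rw [A.step_not hm', Option.some_inj] at hm''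
  exact A.run_append_eq_some.2 ⟨m, hm, hm'' ▸ h3⟩

theorem run_of_red {p q : Q} {u v : List (α × Bool)} (h : FreeGroup.Red u v)
    (hu : A.run p u = some q) : A.run p v = some q := by
  induction h with
  | refl => exact hu
  | tail _ h ih => exact A.run_of_redStep h ih

theorem run_toWord [DecidableEq α] {p q : Q} {u : List (α × Bool)} (hu : A.run p u = some q) :
    A.run p (FreeGroup.mk u).toWord = some q :=
  A.run_of_red (by rw [FreeGroup.toWord_mk]; exact FreeGroup.reduce.red) hu

/-- The elements of the free group that label a loop at a given state. -/
def loops [DecidableEq α] (o : Q) : Subgroup (FreeGroup α) where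
  carrier := {g | A.run o g.toWord = some o}
  one_mem' := by simp
  mul_mem' {g h} hg hh := by
    have := A.run_toWord (A.run_append_eq_some.2 ⟨o, hg, hh⟩)
    rwa [← FreeGroup.mul_mk, FreeGroup.mk_toWord, FreeGroup.mk_toWord] at this
  inv_mem' {g} hg := by
    simpa [FreeGroup.toWord_inv] using A.run_invRev hg

theorem mem_loops [DecidableEq α] {o : Q} {g : FreeGroup α} :
    g ∈ A.loops o ↔ A.run o g.toWord = some o := Iff.rfl

/-- The longest prefix of a word that can be read from a given state. -/
theorem exists_run_or_prefix (q : Q) (w : List (α × Bool)) :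
    (∃ r, A.run q w = some r) ∨
      ∃ p a t r, w = p ++ a :: t ∧ A.run q p = some r ∧ A.step r a = none := by
  induction w generalizing q with
  | nil => exact .inl ⟨q, rfl⟩
  | cons x w ih =>
    rcases hx : A.step q x with _ | m
    · exact .inr ⟨[], x, w, q, rfl, rfl, hx⟩
    · rcases ih m with ⟨r, hr⟩ | ⟨p, a, t, r, rfl, hp, hr⟩
      · exact .inl ⟨r, A.run_cons_eq_some.2 ⟨m, hx, hr⟩⟩
      · exact .inr ⟨x :: p, a, t, r, rfl, A.run_cons_eq_some.2 ⟨m, hx, hp⟩, hr⟩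

/-- The longest suffix of a word that can be read into a given state. -/
theorem exists_run_or_suffix (q : Q) (w : List (α × Bool)) :
    (∃ r, A.run r w = some q) ∨
      ∃ p a t r, w = p ++ a :: t ∧ A.run r t = some q ∧ A.step r (a.1, !a.2) = none := by
  induction w with
  | nil => exact .inl ⟨q, rfl⟩
  | cons x w ih =>
    rcases ih with ⟨r, hr⟩ | ⟨p, a, t, r, rfl, hp, hr⟩
    · rcases hx : A.step r (x.1, !x.2) with _ | m
      · exact .inr ⟨[], x, w, r, rfl, hr, hx⟩
      · exact .inl ⟨m, A.run_cons_eq_some.2 ⟨r, A.step_not_iff.1 hx, hr⟩⟩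
    · exact .inr ⟨x :: p, a, t, r, rfl, hp, hr⟩

/-- The partial injection of a letter extends to a permutation of the states. -/
theorem exists_perm_of_letter [Finite Q] (a : α) :
    ∃ σ : Equiv.Perm Q, ∀ p q, A.step p (a, true) = some q → σ p = q := by
  classical
  choose f hf using fun p : {p // ∃ q, A.step p (a, true) = some q} => p.2
  choose g hg using fun q : {q // ∃ p, A.step q (a, false) = some p} => q.2
  -- The letter is a bijection from its domain to its range; since `Q` is finite, the complements
  -- are equinumerous and it extends.
  let e : {p // ∃ q, A.step p (a, true) = some q} ≃ {q // ∃ p, A.step q (a, false) = some p} :=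
    { toFun := fun p => ⟨f p, p, A.step_not (hf p)⟩
      invFun := fun q => ⟨g q, q, A.step_not (hg q)⟩
      left_inv := fun p => Subtype.ext <| Option.some_inj.1 <|
        (hg ⟨f p, p, A.step_not (hf p)⟩).symm.trans (A.step_not (hf p))
      right_inv := fun q => Subtype.ext <| Option.some_inj.1 <|
        (hf ⟨g q, q, A.step_not (hg q)⟩).symm.trans (A.step_not (hg q)) }
  have := Fintype.ofFinite Q
  refine ⟨e.extendSubtype, fun p q h => ?_⟩
  rw [e.extendSubtype_apply_of_mem p ⟨q, h⟩]
  exact Option.some_inj.1 ((hf ⟨p, q, h⟩).symm.trans h)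

/-- A finite inverse automaton extends to an action of the free group on its states. -/
theorem exists_action [Finite Q] : ∃ φ : FreeGroup α →* Equiv.Perm Q,
    ∀ p q w, A.run p w = some q → (φ (FreeGroup.mk w))⁻¹ p = q := by
  choose σ hσ using A.exists_perm_of_letter
  -- Reading words from left to right is a right action; the inverses turn it into a homomorphism.
  let φ : FreeGroup α →* Equiv.Perm Q := FreeGroup.lift fun a => (σ a)⁻¹
  have hstep : ∀ p q x, A.step p x = some q → (φ (FreeGroup.mk [x]))⁻¹ p = q := by
    rintro p q ⟨a, b⟩ h
    cases b
    · have := hσ a _ _ (A.step_not h)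
      simp [φ, ← this]
    · simpa [φ] using hσ a _ _ h
  refine ⟨φ, fun p q w h => ?_⟩
  induction w generalizing p with
  | nil =>
    have : FreeGroup.mk ([] : List (α × Bool)) = 1 := rfl
    simpa [this] using h
  | cons x w ih =>
    obtain ⟨m, hm, hw⟩ := A.run_cons_eq_some.1 h
    rw [← List.singleton_append, ← FreeGroup.mul_mk, map_mul, mul_inv_rev, Equiv.Perm.mul_apply,
      hstep _ _ _ hm, ih _ hw]

/-- Adds an isolated state. -/
def addState : InverseAutomaton α (Option Q) where
  step p x := p.bind fun p => (A.step p x).map some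
  step_not {p q a b} h := by
    obtain ⟨p, rfl, h1⟩ := Option.bind_eq_some_iff.1 h
    obtain ⟨q, h2, rfl⟩ := Option.map_eq_some_iff.1 h1
    simp [A.step_not h2]

open Classical in
/-- Adds an arc from `v` to `v'`. -/
noncomputable def addArc (v : Q) (x : α × Bool) (v' : Q) (h : A.step v x = none)
    (h' : A.step v' (x.1, !x.2) = none) : InverseAutomaton α Q where
  step p y := if p = v ∧ y = x then some v' else
    if p = v' ∧ y = (x.1, !x.2) then some v else A.step p y
  step_not {p q a b} hs := by
    obtain ⟨c, d⟩ := x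
    split_ifs at hs with h1 h2
    · obtain ⟨rfl, h1⟩ := h1
      obtain rfl := Option.some_inj.1 hs
      obtain ⟨rfl, rfl⟩ := Prod.mk.inj h1
      simp
    · obtain ⟨rfl, h2⟩ := h2
      obtain rfl := Option.some_inj.1 hs
      obtain ⟨rfl, rfl⟩ := Prod.mk.inj h2
      simp
    · have hn := A.step_not hs
      have e1 : ¬ (q = v ∧ (a, !b) = (c, d)) := by
        rintro ⟨rfl, h3⟩
        rw [h3, h] at hn
        cases hn
      have e2 : ¬ (q = v' ∧ (a, !b) = (c, !d)) := by
        rintro ⟨rfl, h3⟩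
        rw [h3, h'] at hn
        cases hn
      rw [if_neg e1, if_neg e2, hn]

theorem addArc_step_self (v : Q) (x : α × Bool) (v' : Q) (h : A.step v x = none)
    (h' : A.step v' (x.1, !x.2) = none) : (A.addArc v x v' h h').step v x = some v' := by
  simp [addArc]

theorem addArc_step_of_eq_some {v : Q} {x : α × Bool} {v' : Q} {h : A.step v x = none}
    {h' : A.step v' (x.1, !x.2) = none} {p q : Q} {y : α × Bool} (hs : A.step p y = some q) :
    (A.addArc v x v' h h').step p y = some q := by
  have e1 : ¬ (p = v ∧ y = x) := by
    rintro ⟨rfl, rfl⟩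
    rw [h] at hs
    cases hs
  have e2 : ¬ (p = v' ∧ y = (x.1, !x.2)) := by
    rintro ⟨rfl, rfl⟩
    rw [h'] at hs
    cases hs
  simp only [addArc, if_neg e1, if_neg e2, hs]

theorem addArc_step_eq_none {v : Q} {x : α × Bool} {v' : Q} {h : A.step v x = none}
    {h' : A.step v' (x.1, !x.2) = none} {p : Q} {y : α × Bool} (hs : A.step p y = none)
    (e1 : ¬ (p = v ∧ y = x)) (e2 : ¬ (p = v' ∧ y = (x.1, !x.2))) :
    (A.addArc v x v' h h').step p y = none := by
  simp only [addArc, if_neg e1, if_neg e2, hs]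

/-- A map of states that is compatible with the arcs. -/
def IsHom {Q' : Type*} (A' : InverseAutomaton α Q') (e : Q → Q') : Prop :=
  ∀ p x q, A.step p x = some q → A'.step (e p) x = some (e q)

variable {A} in
theorem IsHom.run {Q' : Type*} {A' : InverseAutomaton α Q'} {e : Q → Q'} (he : A.IsHom A' e)
    {p q : Q} {w : List (α × Bool)} (h : A.run p w = some q) : A'.run (e p) w = some (e q) := by
  induction w generalizing p with
  | nil => simpa using congrArg (Option.map e) h
  | cons x w ih =>
    obtain ⟨m, hm, hw⟩ := A.run_cons_eq_some.1 h
    exact A'.run_cons_eq_some.2 ⟨e m, he _ _ _ hm, ih hw⟩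

end InverseAutomaton

/-! ### Attaching a path to an inverse automaton -/

open InverseAutomaton in
/-- A reduced path with new interior states can be added between two states if its two end letters
are not yet defined there. (If the path starts and ends at the same state with mutually inverse
letters, its ends are folded.) -/
theorem InverseAutomaton.exists_addPath {α : Type} (k : ℕ) {Q : Type} [Finite Q]
    (A : InverseAutomaton α Q) (v v' : Q) (x : List (α × Bool)) (hk : x.length = k) (hx : x ≠ [])
    (hred : FreeGroup.IsReduced x) (hhead : ∀ a ∈ x.head?, A.step v a = none)
    (hlast : ∀ a ∈ x.getLast?, A.step v' (a.1, !a.2) = none) :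
    ∃ (Q' : Type) (_ : Finite Q') (A' : InverseAutomaton α Q') (e : Q → Q'),
      Function.Injective e ∧ A.IsHom A' e ∧ A'.run (e v) x = some (e v') ∧
      (2 ≤ x.length → ∃ a w, A'.step (e v) a = some w ∧ w ≠ e v) := by
  -- Each round adds the first arc towards a new state and continues from there. Strong induction is
  -- needed because a folding shortens the path by two letters.
  induction k using Nat.strong_induction_on generalizing Q x v v' with
  | _ k ih =>
  obtain ⟨a, x, rfl⟩ := List.exists_cons_of_ne_nil hx
  have ha : A.step v a = none := hhead a rfl
  rcases x.eq_nil_or_concat with rfl | ⟨t, b, rfl⟩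
  · have hb : A.step v' (a.1, !a.2) = none := hlast a rfl
    refine ⟨Q, inferInstance, A.addArc v a v' ha hb, id, Function.injective_id,
      fun p x q => A.addArc_step_of_eq_some, ?_, by simp⟩
    simp [addArc_step_self]
  simp only [List.concat_eq_append] at *
  have hb : A.step v' (b.1, !b.2) = none := hlast b (by simp [List.getLast?_cons])
  have h1 : A.addState.step (some v) a = none := by simp [addState, ha]
  have h2 : A.addState.step none (a.1, !a.2) = none := by simp [addState]
  let B := A.addState.addArc (some v) a none h1 h2
  have hBA : A.IsHom B some := fun p x q h => by
    apply A.addState.addArc_step_of_eq_some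
    simp [addState, h]
  have hBa : B.step (some v) a = some none := addArc_step_self ..
  have hnone : ∀ c, c ≠ (a.1, !a.2) → B.step none c = none := fun c hc =>
    A.addState.addArc_step_eq_none (by simp [addState]) (by simp) (by simpa using hc)
  have hred' : FreeGroup.IsReduced (t ++ [b]) := hred.infix (List.suffix_cons _ _).isInfix
  have hne : ∀ c ∈ (t ++ [b]).head?, c ≠ (a.1, !a.2) := by
    intro c hc hca
    obtain ⟨y, hy⟩ : ∃ y, t ++ [b] = c :: y := by
      rcases h : t ++ [b] with _ | ⟨d, y⟩
      · simp at h
      · rw [h] at hc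
        simp only [List.head?_cons, Option.mem_def, Option.some_inj] at hc
        exact ⟨y, by rw [hc]⟩
    rw [hy, FreeGroup.isReduced_cons_cons] at hred
    have := hred.1
    simp [hca] at this
  -- In this case the last arc is the arc just added, read backwards: only `t` remains to be
  -- attached, as a loop at the new state `none`.
  by_cases hcase : v' = v ∧ (b.1, !b.2) = a
  · obtain ⟨rfl, hab⟩ := hcase
    have ht : t ≠ [] := by
      rintro rfl
      apply hne b (by simp)
      rw [← hab]
      simp
    obtain ⟨d, hd⟩ : ∃ d, t.getLast? = some d := by
      simpa [← Option.isSome_iff_exists] using ht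
    obtain ⟨Q', hQ', A', e, he, hhom, hrun, -⟩ := ih t.length (by simp at hk; omega) B none none t
      rfl ht (hred'.infix (List.prefix_append _ _).isInfix)
      (fun c hc => hnone c (hne c (by
        rw [List.head?_append_of_ne_nil _ ht]; exact hc)))
      (fun c hc => hnone _ (by
        intro h
        obtain ⟨t', rfl⟩ : ∃ t', t = t' ++ [c] := List.getLast?_eq_some_iff.1 hc
        have h3 : FreeGroup.IsReduced [c, b] := hred'.infix ⟨t', [], by simp⟩
        rw [FreeGroup.isReduced_cons_cons] at h3
        have := h3.1
        rw [← hab] at h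
        simp only [Prod.mk.injEq, Bool.not_not] at h
        have h4 := this h.1
        have h5 := h.2
        rw [h4] at h5
        simp at h5))
    refine ⟨Q', hQ', A', e ∘ some, he.comp (Option.some_injective _),
      fun p x q h => hhom _ _ _ (hBA _ _ _ h), ?_,
      fun _ => ⟨a, e none, hhom _ _ _ hBa, fun h => by simpa using he h⟩⟩
    refine A'.run_cons_eq_some.2 ⟨e none, hhom _ _ _ hBa, A'.run_append_eq_some.2 ⟨_, hrun, ?_⟩⟩
    have := A'.step_not (hhom _ _ _ hBa)
    rw [run_singleton]
    rw [← hab] at this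
    simpa using this
  · obtain ⟨Q', hQ', A', e, he, hhom, hrun, -⟩ := ih (t ++ [b]).length
      (by simp at hk ⊢; omega) B none (some v') (t ++ [b]) rfl (by simp) hred'
      (fun c hc => hnone c (hne c hc)) (fun c hc => by
        obtain rfl : b = c := by simpa using hc
        apply A.addState.addArc_step_eq_none
        · simp [addState, hb]
        · simpa using hcase
        · simp)
    refine ⟨Q', hQ', A', e ∘ some, he.comp (Option.some_injective _),
      fun p x q h => hhom _ _ _ (hBA _ _ _ h), ?_,
      fun _ => ⟨a, e none, hhom _ _ _ hBa, fun h => by simpa using he h⟩⟩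
    exact A'.run_cons_eq_some.2 ⟨e none, hhom _ _ _ hBa, hrun⟩

/-! ### Parts of Schreier graphs -/

/-- `A` is a part of the Schreier graph of `H`, with base point `o`, in which all the reduced words
of `H` can be read: the states are cosets, and the letter `x` leads from `c` to `x⁻¹ • c`. -/
structure IsSchreierPart {α Q : Type*} [DecidableEq α] (H : Subgroup (FreeGroup α))
    (A : InverseAutomaton α Q) (c : Q → FreeGroup α ⧸ H) (o : Q) : Prop where
  injective : Function.Injective c
  base : c o = ((1 : FreeGroup α) : FreeGroup α ⧸ H)
  step : ∀ {p q x}, A.step p x = some q → c q = (FreeGroup.mk [x])⁻¹ • c p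
  le_loops : H ≤ A.loops o

namespace IsSchreierPart

variable {α Q : Type*} [DecidableEq α] {H : Subgroup (FreeGroup α)} {A : InverseAutomaton α Q}
  {c : Q → FreeGroup α ⧸ H} {o : Q}

theorem run (hA : IsSchreierPart H A c o) {p q : Q} {w : List (α × Bool)}
    (h : A.run p w = some q) : c q = (FreeGroup.mk w)⁻¹ • c p := by
  induction w generalizing p with
  | nil =>
    obtain rfl : p = q := by simpa using h
    exact (one_smul _ _).symm
  | cons x w ih =>
    obtain ⟨m, hm, hw⟩ := A.run_cons_eq_some.1 h
    rw [ih hw, hA.step hm, smul_smul, ← mul_inv_rev, FreeGroup.mul_mk, List.singleton_append]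

theorem run_base (hA : IsSchreierPart H A c o) {q : Q} {w : List (α × Bool)}
    (h : A.run o w = some q) : c q = ((FreeGroup.mk w)⁻¹ : FreeGroup α) := by
  rw [hA.run h, hA.base, MulAction.Quotient.smul_coe, smul_eq_mul, mul_one]

theorem run_to_base (hA : IsSchreierPart H A c o) {q : Q} {w : List (α × Bool)}
    (h : A.run q w = some o) : c q = (FreeGroup.mk w : FreeGroup α) := by
  have := hA.run h
  rw [hA.base, eq_inv_smul_iff] at this
  rw [← this, MulAction.Quotient.smul_coe, smul_eq_mul, mul_one]

theorem run_eq_base_iff (hA : IsSchreierPart H A c o) {w : List (α × Bool)}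
    (hw : FreeGroup.IsReduced w) : A.run o w = some o ↔ FreeGroup.mk w ∈ H := by
  constructor
  · intro h
    have := hA.run_to_base h
    rw [hA.base, QuotientGroup.eq] at this
    simpa using this
  · intro h
    have := hA.le_loops h
    rwa [A.mem_loops, FreeGroup.toWord_mk, hw.reduce_eq] at this

end IsSchreierPart

section Subgroup

variable {G : Type*} [Group G]

theorem sup_zpowers_mul_mul_le {H : Subgroup G} {h k : G} (hh : h ∈ H) (hk : k ∈ H) (t : G) :
    H ⊔ Subgroup.zpowers (h * t * k) ≤ H ⊔ Subgroup.zpowers t := by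
  refine sup_le le_sup_left ?_
  rw [Subgroup.zpowers_le]
  exact mul_mem (mul_mem (Subgroup.mem_sup_left hh)
    (Subgroup.mem_sup_right (Subgroup.mem_zpowers t))) (Subgroup.mem_sup_left hk)

/-- The two cosets `c = g⁻¹H` and `c' = g'H` are joined by `y` if `H` and `gyg'` generate the
whole group. -/
def JoinsToTop (H : Subgroup G) (c : G ⧸ H) (y : G) (c' : G ⧸ H) : Prop :=
  ∃ g g' : G, c = (g⁻¹ : G) ∧ c' = g' ∧ H ⊔ Subgroup.zpowers (g * y * g') = ⊤

/-- Other representatives of the two cosets change `g * y * g'` only by factors from `H` on the left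
and on the right, which does not affect the join with `H`. -/
theorem joinsToTop_iff {H : Subgroup G} {c c' : G ⧸ H} {y g g' : G} (hc : c = (g⁻¹ : G))
    (hc' : c' = g') : JoinsToTop H c y c' ↔ H ⊔ Subgroup.zpowers (g * y * g') = ⊤ := by
  refine ⟨?_, fun h => ⟨g, g', hc, hc', h⟩⟩
  rintro ⟨k, k', hk, hk', h⟩
  rw [hc, QuotientGroup.eq, inv_inv] at hk
  rw [hc', QuotientGroup.eq] at hk'
  rw [eq_top_iff, ← h]
  have : k * y * k' = (g * k⁻¹)⁻¹ * (g * y * g') * (g'⁻¹ * k') := by group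
  rw [this]
  exact sup_zpowers_mul_mul_le (inv_mem hk) hk' _

end Subgroup

/-! ### Generation and powers, read off from a Schreier part -/

namespace IsSchreierPart

variable {α Q : Type} [DecidableEq α] {H : Subgroup (FreeGroup α)} {A : InverseAutomaton α Q}
  {c : Q → FreeGroup α ⧸ H} {o : Q}

/-- If a reduced word leaves a finite part of the Schreier graph and comes back by another letter,
then it does not generate the whole group together with `H`. -/
theorem sup_zpowers_ne_top [Finite Q] (hA : IsSchreierPart H A c o) {v v' : Q} {a b : α × Bool}
    {p r s : List (α × Bool)} (hp : A.run o p = some v) (hs : A.run v' s = some o)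
    (ha : A.step v a = none) (hb : A.step v' (b.1, !b.2) = none)
    (hred : FreeGroup.IsReduced (p ++ a :: r ++ b :: s)) :
    H ⊔ Subgroup.zpowers (FreeGroup.mk (p ++ a :: r ++ b :: s)) ≠ ⊤ := by
  intro htop
  obtain ⟨Q', hQ', A', e, he, hhom, hrun, hmove⟩ := A.exists_addPath _ v v' (a :: r ++ [b]) rfl
    (by simp) (hred.infix ⟨p, s, by simp⟩) (by simpa using ha)
    (by simpa [List.getLast?_cons] using hb)
  -- The attached path has at least two letters, so some letter moves `e v`. This will contradict
  -- the fact that the whole group fixes `e o`.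
  obtain ⟨x, w, hw, hne⟩ := hmove (by simp)
  obtain ⟨φ, hφ⟩ := A'.exists_action
  have hfix : ∀ g, φ g (e o) = e o := by
    suffices h : (MulAction.stabilizer (Equiv.Perm Q') (e o)).comap φ = ⊤ by
      intro g
      have : g ∈ (MulAction.stabilizer (Equiv.Perm Q') (e o)).comap φ := h ▸ Subgroup.mem_top g
      simpa [MulAction.mem_stabilizer_iff] using this
    rw [eq_top_iff, ← htop]
    refine sup_le (fun g hg => ?_) ?_
    · have := hφ _ _ _ (hhom.run (hA.le_loops hg))
      rw [FreeGroup.mk_toWord, Equiv.Perm.inv_eq_iff_eq] at this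
      simpa [MulAction.mem_stabilizer_iff] using this.symm
    · rw [Subgroup.zpowers_le]
      have : A'.run (e o) (p ++ a :: r ++ b :: s) = some (e o) := by
        have h : p ++ a :: r ++ b :: s = p ++ ((a :: r ++ [b]) ++ s) := by simp
        rw [h]
        exact A'.run_append_eq_some.2 ⟨_, hhom.run hp, A'.run_append_eq_some.2
          ⟨_, hrun, hhom.run hs⟩⟩
      have := hφ _ _ _ this
      rw [Equiv.Perm.inv_eq_iff_eq] at this
      simpa [MulAction.mem_stabilizer_iff] using this.symm
  -- The state `e v` is reached from the fixed point `e o`, hence equals it.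
  have hv : e v = e o := by
    rw [← hφ _ _ _ (hhom.run hp), Equiv.Perm.inv_eq_iff_eq, hfix]
  apply hne
  rw [← hφ (e v) w [x] (by simpa using hw), hv, Equiv.Perm.inv_eq_iff_eq, hfix]

/-- Whether a reduced word generates the whole group together with `H` can be read off from a
finite part of the Schreier graph. -/
theorem sup_zpowers_eq_top_iff [Finite Q] (hA : IsSchreierPart H A c o) {u : List (α × Bool)}
    (hu : FreeGroup.IsReduced u) : H ⊔ Subgroup.zpowers (FreeGroup.mk u) = ⊤ ↔
      ∃ p y s v v', u = p ++ y ++ s ∧ y.length ≤ 1 ∧ A.run o p = some v ∧ A.run v' s = some o ∧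
        JoinsToTop H (c v) (FreeGroup.mk y) (c v') := by
  have key : ∀ {p y s v v'}, A.run o p = some v → A.run v' s = some o →
      (JoinsToTop H (c v) (FreeGroup.mk y) (c v') ↔
        H ⊔ Subgroup.zpowers (FreeGroup.mk (p ++ y ++ s)) = ⊤) := fun hp hs => by
    rw [joinsToTop_iff (hA.run_base hp) (hA.run_to_base hs), FreeGroup.mul_mk, FreeGroup.mul_mk]
  constructor
  · intro h
    rcases A.exists_run_or_prefix o u with ⟨v, hv⟩ | ⟨p, a, t, v, rfl, hp, ha⟩
    · refine ⟨u, [], [], v, o, by simp, by simp, hv, rfl, ?_⟩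
      rw [key hv (A.run_nil o)]
      simpa using h
    -- The suffix is sought only in the unread rest of `u`, so it cannot overlap the prefix `p`.
    rcases A.exists_run_or_suffix o (a :: t) with ⟨v', hv'⟩ | ⟨r, b, s, v', ht, hs, hb⟩
    · refine ⟨p, [], a :: t, v, v', by simp, by simp, hp, hv', ?_⟩
      rw [key hp hv']
      simpa using h
    rcases r with _ | ⟨d, r⟩
    · rw [List.nil_append] at ht
      rw [ht] at h ⊢
      refine ⟨p, [b], s, v, v', by simp, by simp, hp, hs, ?_⟩
      rw [key hp hs]
      simpa using h
    · obtain rfl : a = d := (List.cons.inj ht).1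
      rw [ht, ← List.append_assoc] at h hu
      exact absurd h (hA.sup_zpowers_ne_top hp hs ha hb hu)
  · rintro ⟨p, y, s, v, v', rfl, -, hp, hs, h⟩
    exact (key hp hs).1 h

/-- Cyclic reducedness enters here: the concatenated copies of `u` form a reduced word, which can be
read in `A` whenever it represents an element of `H`. -/
theorem pow_mem_iff (hA : IsSchreierPart H A c o) {u : List (α × Bool)}
    (hu : FreeGroup.IsCyclicallyReduced u) (k : ℕ) :
    FreeGroup.mk u ^ k ∈ H ↔ A.run o (List.replicate k u).flatten = some o := by
  rw [FreeGroup.pow_mk, hA.run_eq_base_iff (hu.flatten_replicate k).isReduced]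

end IsSchreierPart

theorem FreeGroup.IsCyclicallyReduced.pow_ne_one {α : Type*} [DecidableEq α] {u : List (α × Bool)}
    (hu : FreeGroup.IsCyclicallyReduced u) (hne : u ≠ []) {k : ℕ} (hk : k ≠ 0) :
    FreeGroup.mk u ^ k ≠ 1 := by
  rw [FreeGroup.pow_mk, ne_eq, ← FreeGroup.toWord_eq_nil_iff, FreeGroup.toWord_mk,
    (hu.flatten_replicate k).isReduced.reduce_eq]
  simp [hne, hk]

theorem FreeGroup.IsCyclicallyReduced.inf_zpowers_eq_bot_iff {α : Type*} [DecidableEq α]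
    {H : Subgroup (FreeGroup α)} {u : List (α × Bool)} (hu : FreeGroup.IsCyclicallyReduced u) :
    H ⊓ Subgroup.zpowers (FreeGroup.mk u) = ⊥ ↔
      (u ≠ [] → ∀ k, k ≠ 0 → FreeGroup.mk u ^ k ∉ H) := by
  constructor
  · intro h hne k hk hmem
    apply hu.pow_ne_one hne hk
    rw [← Subgroup.mem_bot, ← h]
    exact ⟨hmem, Subgroup.npow_mem_zpowers _ _⟩
  · intro h
    rw [eq_bot_iff]
    rintro g ⟨hg, hz⟩
    obtain ⟨z, rfl⟩ := Subgroup.mem_zpowers_iff.1 hz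
    rw [Subgroup.mem_bot]
    by_cases hne : u = []
    · subst hne
      exact one_zpow z
    by_cases hz0 : z = 0
    · simp [hz0]
    refine absurd ?_ (h hne z.natAbs (by simpa using hz0))
    rw [← zpow_natCast]
    rcases Int.natAbs_eq z with h | h
    · exact h ▸ hg
    · rw [h, zpow_neg] at hg
      exact inv_mem_iff.1 hg

/-- Only finitely many powers have to be tested. -/
theorem IsSchreierPart.forall_pow_notMem_iff {α Q : Type} [DecidableEq α] [Finite Q]
    {H : Subgroup (FreeGroup α)} {A : InverseAutomaton α Q} {c : Q → FreeGroup α ⧸ H} {o : Q}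
    (hA : IsSchreierPart H A c o) {u : List (α × Bool)} (hu : FreeGroup.IsCyclicallyReduced u)
    {K : ℕ} (hK : Nat.card Q ≤ K) : (∀ k, k ≠ 0 → FreeGroup.mk u ^ k ∉ H) ↔
      ∀ k < K, FreeGroup.mk u ^ (k + 1) ∉ H := by
  refine ⟨fun h k _ => h _ (by simp), fun h k hk hmem => ?_⟩
  -- Every power `u ^ i` is a prefix of the word `u ^ (k * i)`, which is readable because it
  -- represents an element of `H`.
  have hrun : ∀ i : ℕ, ∃ q, A.run o (List.replicate i u).flatten = some q := by
    intro i
    have h1 : FreeGroup.mk u ^ (k * i) ∈ H := by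
      rw [pow_mul]
      exact pow_mem hmem i
    rw [hA.pow_mem_iff hu] at h1
    have h2 : k * i = i + (k * i - i) := by
      have : i ≤ k * i := Nat.le_mul_of_pos_left i (Nat.pos_of_ne_zero hk)
      omega
    rw [h2, List.replicate_add, List.flatten_append, A.run_append_eq_some] at h1
    obtain ⟨q, hq, -⟩ := h1
    exact ⟨q, hq⟩
  choose f hf using hrun
  -- Two of the powers with exponents `0, …, K` reach the same state, hence the same coset; their
  -- quotient is a power in `H` with exponent between `1` and `K`.
  have hinj : ¬ Function.Injective fun i : Fin (K + 1) => f i := by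
    intro hi
    have := Nat.card_le_card_of_injective _ hi
    simp at this
    omega
  simp only [Function.Injective, not_forall] at hinj
  obtain ⟨i, j, hij, hne⟩ := hinj
  wlog hlt : i < j generalizing i j
  · exact this j i hij.symm (Ne.symm hne) (lt_of_le_of_ne (not_lt.1 hlt) (Ne.symm hne))
  have h1 := hA.run_base (hf i)
  have h2 := hA.run_base (hf j)
  rw [hij, h2, QuotientGroup.eq, inv_inv, ← FreeGroup.pow_mk, ← FreeGroup.pow_mk] at h1
  have hval : (i : ℕ) < j := hlt
  apply h (j - i - 1) (by omega)
  have h3 : (j : ℕ) - i - 1 + 1 = j - i := by omega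
  rwa [h3, pow_sub _ hval.le]

/-! ### Existence of finite Schreier parts -/

/-- The part of the Schreier graph of `H` on a set of cosets. -/
noncomputable def schreierPart {α : Type*} (H : Subgroup (FreeGroup α))
    (V : Set (FreeGroup α ⧸ H)) : InverseAutomaton α V := by
  classical
  exact
  { step := fun p x => if h : (FreeGroup.mk [x])⁻¹ • p.1 ∈ V then some ⟨_, h⟩ else none
    step_not := by
      intro p q a b h
      split_ifs at h with hp
      obtain rfl := Option.some_inj.1 h
      have h1 : (FreeGroup.mk [(a, !b)])⁻¹ • (FreeGroup.mk [(a, b)])⁻¹ • p.1 = p.1 := by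
        rw [smul_smul, ← mul_inv_rev, FreeGroup.mul_mk]
        have : FreeGroup.mk ([(a, b)] ++ [(a, !b)]) = 1 :=
          Quot.sound (FreeGroup.Red.Step.cons_not)
        rw [this, inv_one, one_smul]
      simp only [h1]
      rw [dif_pos p.2] }

theorem schreierPart_step {α : Type*} {H : Subgroup (FreeGroup α)} {V : Set (FreeGroup α ⧸ H)}
    {p q : V} {x : α × Bool} :
    (schreierPart H V).step p x = some q ↔ q.1 = (FreeGroup.mk [x])⁻¹ • p.1 := by
  classical
  simp only [schreierPart]
  split_ifs with h
  · rw [Option.some_inj, Subtype.ext_iff, eq_comm]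
  · simp only [false_iff]
    intro hq
    exact h (hq ▸ q.2)

theorem schreierPart_run {α : Type*} {H : Subgroup (FreeGroup α)} {V : Set (FreeGroup α ⧸ H)}
    {p : V} {w : List (α × Bool)} (h : ∀ u, u <+: w → (FreeGroup.mk u)⁻¹ • p.1 ∈ V) :
    (schreierPart H V).run p w = some ⟨_, h w (List.prefix_refl w)⟩ := by
  induction w generalizing p with
  | nil => simp [← FreeGroup.one_eq_mk]
  | cons x w ih =>
    have hx : (FreeGroup.mk [x])⁻¹ • p.1 ∈ V := h [x] (by simp)
    have e : ∀ u, (FreeGroup.mk (x :: u))⁻¹ • p.1 =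
        (FreeGroup.mk u)⁻¹ • (FreeGroup.mk [x])⁻¹ • p.1 := fun u => by
      rw [smul_smul, ← mul_inv_rev, FreeGroup.mul_mk, List.singleton_append]
    rw [InverseAutomaton.run_cons_eq_some]
    refine ⟨⟨_, hx⟩, schreierPart_step.2 rfl, ?_⟩
    rw [ih (p := ⟨_, hx⟩) fun u hu => by
      rw [← e]
      exact h _ (by simpa using hu)]
    exact congrArg some (Subtype.ext (e w).symm)

/-- A bound for the number of cosets of the prefixes of the words in a list. -/
def prefixBound {β : Type*} (ws : List (List β)) : ℕ := 1 + (ws.length + ws.flatten.length)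

/-- A finitely generated subgroup has a finite part of its Schreier graph in which all the words in
a given list can be read. -/
theorem exists_isSchreierPart {α : Type} [DecidableEq α] (gens ws : List (List (α × Bool)))
    (hws : gens ⊆ ws) :
    let H := Subgroup.closure {g | ∃ w ∈ gens, FreeGroup.mk w = g}
    ∃ (Q : Type) (_ : Finite Q) (A : InverseAutomaton α Q) (c : Q → FreeGroup α ⧸ H) (o : Q),
      IsSchreierPart H A c o ∧ Nat.card Q ≤ prefixBound ws ∧ ∀ w ∈ ws, ∃ q, A.run o w = some q := by
  intro H
  let coset : List (α × Bool) → FreeGroup α ⧸ H := fun u => ((FreeGroup.mk u)⁻¹ : FreeGroup α)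
  let l : List (FreeGroup α ⧸ H) :=
    ((1 : FreeGroup α) : FreeGroup α ⧸ H) :: ws.flatMap fun w => w.inits.map coset
  let V : Set (FreeGroup α ⧸ H) := {x | x ∈ l}
  have hfin : V.Finite := List.finite_toSet l
  let o : V := ⟨((1 : FreeGroup α) : FreeGroup α ⧸ H), by simp [V, l]⟩
  have hrun : ∀ w ∈ ws, ∃ q, (schreierPart H V).run o w = some q ∧ q.1 = coset w := by
    intro w hw
    have hcos : ∀ u, (FreeGroup.mk u)⁻¹ • o.1 = coset u := fun u => by
      simp [o, coset]
    refine ⟨_, schreierPart_run fun u hu => ?_, hcos w⟩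
    rw [hcos]
    refine List.mem_cons_of_mem _ (List.mem_flatMap.2 ⟨w, hw, List.mem_map.2 ⟨u, ?_, rfl⟩⟩)
    exact (List.mem_inits _ _).2 hu
  refine ⟨V, hfin.to_subtype, schreierPart H V, Subtype.val, o, ⟨Subtype.val_injective, rfl,
    schreierPart_step.1, ?_⟩, ?_, fun w hw => (hrun w hw).imp fun _ h => h.1⟩
  · rw [Subgroup.closure_le]
    rintro g ⟨w, hw, rfl⟩
    obtain ⟨q, hq, hqw⟩ := hrun w (hws hw)
    have : q = o := by
      apply Subtype.ext
      rw [hqw]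
      simp only [o, coset]
      rw [QuotientGroup.eq]
      simpa using (Subgroup.subset_closure ⟨w, hw, rfl⟩ : FreeGroup.mk w ∈ H)
    exact InverseAutomaton.run_toWord _ (this ▸ hq)
  · have h1 : Nat.card V ≤ l.length := by
      classical
      have : V = (l.toFinset : Set _) := by ext; simp [V]
      rw [this, Nat.card_coe_set_eq, Set.ncard_coe_finset]
      exact l.toFinset_card_le
    refine h1.trans ?_
    simp only [l, List.length_cons, List.length_flatMap, List.length_map, List.length_inits,
      prefixBound, List.length_flatten]
    clear * -
    have : (ws.map fun w => w.length + 1).sum = ws.length + (ws.map List.length).sum := by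
      induction ws with
      | nil => rfl
      | cons w ws ih => simp [ih]; omega
    omega

/-! ### The language of cocycles has finitely many left quotients -/

/-- The cyclically reduced words that represent `⊕`-cocycles of `H`. -/
def cocycleWords {α : Type*} (H : Subgroup (FreeGroup α)) : Language (α × Bool) :=
  {w | FreeGroup.IsCyclicallyReduced w ∧ FreeGroup.mk w ∈ directCocycles H}

theorem mem_cocycleWords_iff_exists_toWord {n : ℕ} {H : Subgroup (FreeGroup (Fin n))}
    {w : List (Fin n × Bool)} : w ∈ cocycleWords H ↔
      ∃ u ∈ directCocycles H ∩ cyclicallyReducedElements n, u.toWord = w := by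
  constructor
  · rintro ⟨h1, h2⟩
    have : (FreeGroup.mk w).toWord = w := by rw [FreeGroup.toWord_mk, h1.isReduced.reduce_eq]
    refine ⟨FreeGroup.mk w, ⟨h2, ?_⟩, this⟩
    change FreeGroup.IsCyclicallyReduced _
    rwa [this]
  · rintro ⟨u, ⟨h1, h2⟩, rfl⟩
    exact ⟨h2, by rwa [FreeGroup.mk_toWord]⟩

namespace IsSchreierPart

variable {α Q : Type} [DecidableEq α] {H : Subgroup (FreeGroup α)} {A : InverseAutomaton α Q}
  {c : Q → FreeGroup α ⧸ H} {o : Q}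

/-- The states that can be reached from the base point by reading a word, with one jump
along a pair of cosets that generates the whole group. -/
def jumpStates (_ : IsSchreierPart H A c o) (w : List (α × Bool)) : Set Q :=
  {q | ∃ p y s v t, w = p ++ y ++ s ∧ y.length ≤ 1 ∧ A.run o p = some v ∧ A.run t s = some q ∧
    JoinsToTop H (c v) (FreeGroup.mk y) (c t)}

/-- The data about a word that determine its continuations to words of `⊕`-cocycles. -/
def profile (hA : IsSchreierPart H A c o) (w : List (α × Bool)) :
    Prop × Option (α × Bool) × Option (α × Bool) × (Q → Option Q) × Set Q :=
  (FreeGroup.IsReduced w, w.head?, w.getLast?, fun q => A.run q w, hA.jumpStates w)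

theorem mem_cocycleWords_iff [Finite Q] (hA : IsSchreierPart H A c o) {w : List (α × Bool)} :
    w ∈ cocycleWords H ↔ FreeGroup.IsCyclicallyReduced w ∧ o ∈ hA.jumpStates w ∧
      (w ≠ [] → ∀ k, k ≠ 0 → A.run o (List.replicate k w).flatten ≠ some o) := by
  refine and_congr_right fun hw => and_congr (hA.sup_zpowers_eq_top_iff hw.isReduced) ?_
  rw [hw.inf_zpowers_eq_bot_iff]
  simp only [hA.pow_mem_iff hw, ne_eq]

/-- A jump of at most one letter cannot straddle the boundary between `w` and `z`, so it lies in one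
of the two words. -/
theorem mem_jumpStates_append (hA : IsSchreierPart H A c o) {w z : List (α × Bool)} {q : Q} :
    q ∈ hA.jumpStates (w ++ z) ↔ (∃ r ∈ hA.jumpStates w, A.run r z = some q) ∨
      ∃ m, A.run o w = some m ∧ ∃ p y s v v', z = p ++ y ++ s ∧ y.length ≤ 1 ∧
        A.run m p = some v ∧ A.run v' s = some q ∧
        JoinsToTop H (c v) (FreeGroup.mk y) (c v') := by
  constructor
  · rintro ⟨p, y, s, v, v', h, hy, hp, hs, hj⟩
    rw [List.append_assoc] at h
    rcases List.append_eq_append_iff.1 h with ⟨p', rfl, rfl⟩ | ⟨t, rfl, ht⟩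
    · obtain ⟨m, hm, hp'⟩ := A.run_append_eq_some.1 hp
      exact .inr ⟨m, hm, p', y, s, v, v', by simp, hy, hp', hs, hj⟩
    · rcases List.append_eq_append_iff.1 ht with ⟨t', rfl, rfl⟩ | ⟨z', rfl, rfl⟩
      · obtain ⟨m, hm, hs'⟩ := A.run_append_eq_some.1 hs
        exact .inl ⟨m, ⟨p, y, t', v, v', by simp, hy, hp, hm, hj⟩, hs'⟩
      · rcases t with _ | ⟨x, t⟩
        · exact .inr ⟨v, by simpa using hp, [], z', s, v, v', by simp, hy, rfl, hs, hj⟩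
        · obtain rfl : z' = [] := by
            rw [← List.length_eq_zero_iff]
            simp only [List.length_append, List.length_cons] at hy
            omega
          rw [List.append_nil] at hy hj
          exact .inl ⟨v', ⟨p, x :: t, [], v, v', by simp, hy, hp, rfl, hj⟩, by simpa using hs⟩
  · rintro (⟨r, ⟨p, y, s, v, v', rfl, hy, hp, hs, hj⟩, hr⟩ |
      ⟨m, hm, p, y, s, v, v', rfl, hy, hp, hs, hj⟩)
    · exact ⟨p, y, s ++ z, v, v', by simp, hy, hp, A.run_append_eq_some.2 ⟨r, hs, hr⟩, hj⟩
    · exact ⟨w ++ p, y, s, v, v', by simp, hy, A.run_append_eq_some.2 ⟨m, hm, hp⟩, hs, hj⟩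

/-- Reducedness and the end letters control cyclic reducedness, the jump states and the run from `o`
control generation, and the whole partial map of states controls the powers of `w ++ z`. -/
theorem mem_cocycleWords_of_profile_eq [Finite Q] (hA : IsSchreierPart H A c o)
    {w w' : List (α × Bool)} (h : hA.profile w = hA.profile w') {z : List (α × Bool)}
    (hz : w ++ z ∈ cocycleWords H) : w' ++ z ∈ cocycleWords H := by
  simp only [profile, Prod.mk.injEq] at h
  obtain ⟨hred, hhead, hlast, hrun, hjump⟩ := h
  have hrun' : ∀ q, A.run q w = A.run q w' := fun q => congrFun hrun q
  rw [hA.mem_cocycleWords_iff] at hz ⊢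
  obtain ⟨h1, h2, h3⟩ := hz
  refine ⟨?_, ?_, ?_⟩
  · simp only [FreeGroup.isCyclicallyReduced_iff, FreeGroup.IsReduced, List.isChain_append,
      List.head?_append, List.getLast?_append] at h1 hred ⊢
    rwa [← hred, ← hhead, ← hlast]
  · rw [hA.mem_jumpStates_append] at h2 ⊢
    rwa [← hjump, ← hrun']
  · intro hne k hk
    have hne' : w ++ z ≠ [] := by
      intro h
      obtain ⟨rfl, rfl⟩ := List.append_eq_nil_iff.1 h
      have : w' = [] := by simpa [eq_comm] using hhead
      simp [this] at hne
    have e : ∀ k q, A.run q (List.replicate k (w' ++ z)).flatten =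
        A.run q (List.replicate k (w ++ z)).flatten := by
      intro k
      induction k with
      | zero => simp
      | succ k ih =>
        intro q
        simp only [List.replicate_succ, List.flatten_cons, A.run_append, hrun', ih]
    rw [e]
    exact h3 hne' k hk

end IsSchreierPart

theorem Language.card_range_leftQuotient_le {β S : Type*} [Finite S] {L : Language β}
    (f : List β → S) (hf : ∀ {w w' z}, f w = f w' → w ++ z ∈ L → w' ++ z ∈ L) :
    (Set.range L.leftQuotient).Finite ∧ Nat.card (Set.range L.leftQuotient) ≤ Nat.card S := by
  choose g hg using fun x : Set.range L.leftQuotient => x.2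
  have hinj : Function.Injective fun x => f (g x) := by
    intro x y hxy
    apply Subtype.ext
    rw [← hg x, ← hg y]
    ext z
    exact ⟨hf hxy, hf hxy.symm⟩
  exact ⟨Set.finite_coe_iff.1 (Finite.of_injective _ hinj), Nat.card_le_card_of_injective _ hinj⟩

/-- A bound for the number of states of the minimal automaton of the words of `⊕`-cocycles. -/
def quotientBound (n K : ℕ) : ℕ :=
  2 * ((n * 2 + 1) * ((n * 2 + 1) * ((K + 1) ^ K * 2 ^ K)))

/-- The factors of `quotientBound` count the possible values of the five components of `profile`,
for at most `prefixBound gens` states. -/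
theorem card_leftQuotient_cocycleWords_le {n : ℕ} (gens : List (List (Fin n × Bool))) :
    (Set.range (cocycleWords (generatedSubgroup gens)).leftQuotient).Finite ∧
      Nat.card (Set.range (cocycleWords (generatedSubgroup gens)).leftQuotient) ≤
        quotientBound n (prefixBound gens) := by
  obtain ⟨Q, hQ, A, c, o, hA, hcard, -⟩ := exists_isSchreierPart gens gens (List.Subset.refl _)
  obtain ⟨h1, h2⟩ := Language.card_range_leftQuotient_le hA.profile
    fun h hz => hA.mem_cocycleWords_of_profile_eq h hz
  refine ⟨h1, h2.trans ?_⟩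
  have := Fintype.ofFinite Q
  have e : Nat.card (Set Q) = 2 ^ Nat.card Q := by
    classical
    simp [Nat.card_eq_fintype_card]
  rw [Nat.card_prod, Nat.card_prod, Nat.card_prod, Nat.card_prod, e, Nat.card_fun,
    Finite.card_option, Finite.card_option, Nat.card_prod, Nat.card_fin]
  have hP : Nat.card Prop = 2 := by simp [Nat.card_eq_fintype_card]
  have hB : Nat.card Bool = 2 := by simp [Nat.card_eq_fintype_card]
  rw [hP, hB, quotientBound]
  gcongr
  · exact Nat.succ_pos _
  · norm_num

/-! ### Recovering an automaton from a bound on the left quotients -/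

section Nerode

variable {β S : Type*}

/-- The values of a right congruence of finite index are attained on short words. -/
theorem exists_short_word [Finite S] (f : List β → S)
    (hf : ∀ {x y : List β} (z : List β), f x = f y → f (x ++ z) = f (y ++ z)) (w : List β) :
    ∃ w' : List β, w'.length ≤ Nat.card S ∧ f w' = f w := by
  induction hk : w.length using Nat.strong_induction_on generalizing w with
  | _ k ih =>
  by_cases hle : w.length ≤ Nat.card S
  · exact ⟨w, hle, rfl⟩
  -- Two prefixes share a value; cutting out the factor between them preserves the value of the
  -- whole word.
  have hinj : ¬ Function.Injective fun i : Fin (Nat.card S + 1) => f (w.take i) := by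
    intro hi
    have := Nat.card_le_card_of_injective _ hi
    simp at this
  simp only [Function.Injective, not_forall] at hinj
  obtain ⟨i, j, hij, hne⟩ := hinj
  wlog hlt : i < j generalizing i j
  · exact this j i hij.symm (Ne.symm hne) (lt_of_le_of_ne (not_lt.1 hlt) (Ne.symm hne))
  have hlt' : (i : ℕ) < j := hlt
  have hj := j.2
  have hfw := hf (w.drop j) hij
  rw [List.take_append_drop] at hfw
  obtain ⟨w', h1, h2⟩ := ih (w.take i ++ w.drop j).length (by simp; omega) _ rfl
  exact ⟨w', h1, h2.trans hfw⟩

variable {L : Language β}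

theorem Language.leftQuotient_append_congr {x y : List β} (z : List β)
    (h : L.leftQuotient x = L.leftQuotient y) :
    L.leftQuotient (x ++ z) = L.leftQuotient (y ++ z) := by
  rw [Language.leftQuotient_append, Language.leftQuotient_append, h]

theorem Language.exists_short_leftQuotient_eq (hfin : (Set.range L.leftQuotient).Finite)
    (w : List β) : ∃ w' : List β, w'.length ≤ Nat.card (Set.range L.leftQuotient) ∧
      L.leftQuotient w' = L.leftQuotient w := by
  have := hfin.to_subtype
  obtain ⟨w', h1, h2⟩ := exists_short_word (Set.rangeFactorization L.leftQuotient)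
    (fun {x y} z h => Subtype.ext (Language.leftQuotient_append_congr z (congrArg Subtype.val h))) w
  exact ⟨w', h1, congrArg Subtype.val h2⟩

/-- Different left quotients are separated by short words. -/
theorem Language.leftQuotient_eq_of_forall_short (hfin : (Set.range L.leftQuotient).Finite)
    {w w' : List β} (h : ∀ z : List β, z.length ≤ Nat.card (Set.range L.leftQuotient) ^ 2 →
      (w ++ z ∈ L ↔ w' ++ z ∈ L)) : L.leftQuotient w = L.leftQuotient w' := by
  have := hfin.to_subtype
  ext z
  -- The short-word principle is applied to the pair of quotients of `w ++ z` and `w' ++ z`; pairs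
  -- account for the square in the bound.
  obtain ⟨t, h1, h2⟩ := exists_short_word
    (fun z => (Set.rangeFactorization L.leftQuotient (w ++ z),
      Set.rangeFactorization L.leftQuotient (w' ++ z)))
    (fun {x y} z h => by
      simp only [Prod.mk.injEq, Subtype.ext_iff, Set.rangeFactorization_coe] at h ⊢
      simp only [← List.append_assoc]
      exact ⟨Language.leftQuotient_append_congr z h.1,
        Language.leftQuotient_append_congr z h.2⟩) z
  rw [Nat.card_prod, ← sq] at h1
  simp only [Prod.mk.injEq, Subtype.ext_iff, Set.rangeFactorization_coe] at h2
  have e : ∀ u, u ∈ L ↔ [] ∈ L.leftQuotient u := fun u => by simp [Language.mem_leftQuotient]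
  rw [Language.mem_leftQuotient, Language.mem_leftQuotient, e, e (w' ++ z), ← h2.1, ← h2.2, ← e,
    ← e]
  exact h t h1

/-- An automaton whose states carry the short words, with arcs that respect the left quotients as
far as short words can tell. -/
theorem NFA.accepts_eq_of_shortWords {σ : Type*} (M : NFA β σ) (word : σ → List β) (N : ℕ)
    (hfin : (Set.range L.leftQuotient).Finite)
    (hN : Nat.card (Set.range L.leftQuotient) ^ 2 ≤ N)
    (hword : ∀ w : List β, w.length ≤ N → ∃ s, word s = w)
    (hstart : ∀ s, s ∈ M.start ↔ word s = [])
    (haccept : ∀ s, s ∈ M.accept ↔ word s ∈ L)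
    (hstep : ∀ s x t, t ∈ M.step s x ↔
      ∀ z : List β, z.length ≤ N → (word s ++ x :: z ∈ L ↔ word t ++ z ∈ L)) :
    M.accepts = L := by
  have hstep' : ∀ s x t, t ∈ M.step s x ↔
      L.leftQuotient (word s ++ [x]) = L.leftQuotient (word t) := by
    intro s x t
    rw [hstep]
    constructor
    · intro h
      refine Language.leftQuotient_eq_of_forall_short hfin fun z hz => ?_
      simpa using h z (hz.trans hN)
    · intro h z _
      have : z ∈ L.leftQuotient (word s ++ [x]) ↔ z ∈ L.leftQuotient (word t) := by rw [h]
      simpa [Language.mem_leftQuotient] using this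
  have hex : ∀ w, ∃ s, L.leftQuotient (word s) = L.leftQuotient w := by
    intro w
    obtain ⟨w', h1, h2⟩ := Language.exists_short_leftQuotient_eq hfin w
    obtain ⟨s, rfl⟩ := hword w' (h1.trans ((Nat.le_self_pow two_ne_zero _).trans hN))
    exact ⟨s, h2⟩
  -- Several words may represent one quotient, so `M` is not deterministic; still, every state
  -- reached by `w` carries the quotient of `w`, and `hcomplete` shows that some state is reached.
  have hsound : ∀ w s, s ∈ M.eval w → L.leftQuotient (word s) = L.leftQuotient w := by
    intro w
    induction w using List.reverseRecOn with
    | nil =>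
      intro s hs
      rw [(hstart s).1 hs]
    | append_singleton w x ih =>
      intro t ht
      rw [NFA.eval_append_singleton, NFA.mem_stepSet] at ht
      obtain ⟨s, hs, hst⟩ := ht
      rw [← (hstep' s x t).1 hst]
      exact Language.leftQuotient_append_congr _ (ih s hs)
  have hcomplete : ∀ w, ∃ s, s ∈ M.eval w := by
    intro w
    induction w using List.reverseRecOn with
    | nil =>
      obtain ⟨s, hs⟩ := hword [] (Nat.zero_le _)
      exact ⟨s, (hstart s).2 hs⟩
    | append_singleton w x ih =>
      obtain ⟨s, hs⟩ := ih
      obtain ⟨t, ht⟩ := hex (word s ++ [x])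
      refine ⟨t, ?_⟩
      rw [NFA.eval_append_singleton, NFA.mem_stepSet]
      exact ⟨s, hs, (hstep' s x t).2 ht.symm⟩
  have e : ∀ u, u ∈ L ↔ [] ∈ L.leftQuotient u := fun u => by simp [Language.mem_leftQuotient]
  ext w
  constructor
  · rintro ⟨s, hs, hsw⟩
    rw [e, ← hsound w s hsw, ← e]
    exact (haccept s).1 hs
  · intro hw
    obtain ⟨s, hs⟩ := hcomplete w
    refine ⟨s, (haccept s).2 ?_, hs⟩
    rwa [e, hsound w s hs, ← e]

end Nerode

/-! ### Certificates for membership and non-membership in a subgroup -/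

section Membership

/-- The composition of the transpositions in a list, applied to a number. -/
def applySwaps (l : List (ℕ × ℕ)) (q : ℕ) : ℕ :=
  l.foldr (fun p x => if x = p.1 then p.2 else if x = p.2 then p.1 else x) q

/-- The action on `ℕ` of a word, for a table that lists for each letter a product of
transpositions. -/
def runTable (T : List (List (ℕ × ℕ))) (q : ℕ) (w : List (ℕ × Bool)) : ℕ :=
  w.foldl (fun q x => cond x.2 (applySwaps (T.getD x.1 []) q)
    (applySwaps (T.getD x.1 []).reverse q)) q

/-- The product of the transpositions in a list. -/
def swapsPerm (l : List (ℕ × ℕ)) : Equiv.Perm ℕ := (l.map fun p => Equiv.swap p.1 p.2).prod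

theorem applySwaps_eq (l : List (ℕ × ℕ)) (q : ℕ) : applySwaps l q = swapsPerm l q := by
  induction l with
  | nil => rfl
  | cons p l ih =>
    change (if applySwaps l q = p.1 then p.2 else
      if applySwaps l q = p.2 then p.1 else applySwaps l q) = _
    rw [ih, ← Equiv.swap_apply_def]
    simp [swapsPerm]

theorem swapsPerm_reverse (l : List (ℕ × ℕ)) : swapsPerm l.reverse = (swapsPerm l)⁻¹ := by
  simp [swapsPerm, List.prod_inv_reverse, Function.comp_def]

theorem runTable_eq (T : List (List (ℕ × ℕ))) (q : ℕ) (w : List (ℕ × Bool)) :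
    runTable T q w =
      (FreeGroup.lift (fun i => (swapsPerm (T.getD i []))⁻¹) (FreeGroup.mk w))⁻¹ q := by
  induction w generalizing q with
  | nil => rfl
  | cons x w ih =>
    have : runTable T q (x :: w) = runTable T (cond x.2 (applySwaps (T.getD x.1 []) q)
      (applySwaps (T.getD x.1 []).reverse q)) w := rfl
    rw [this, ih, ← List.singleton_append, ← FreeGroup.mul_mk, map_mul, mul_inv_rev,
      Equiv.Perm.mul_apply]
    congr 1
    obtain ⟨i, b⟩ := x
    cases b <;> simp [applySwaps_eq, swapsPerm_reverse, FreeGroup.lift_mk]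

/-- The subgroup of the free group on the natural numbers generated by words. -/
def rawSubgroup (gens : List (List (ℕ × Bool))) : Subgroup (FreeGroup ℕ) :=
  Subgroup.closure {g | ∃ w ∈ gens, FreeGroup.mk w = g}

/-- Every list of transpositions defines a permutation of `ℕ`, so a search over tables needs no
validity check. This lemma shows that such tables capture all finite actions. -/
theorem exists_swaps {Q : Type*} [Finite Q] (e : Q ↪ ℕ) (σ : Equiv.Perm Q) :
    ∃ l : List (ℕ × ℕ), ∀ q, swapsPerm l (e q) = e (σ q) := by
  classical
  induction σ using Equiv.Perm.swap_induction_on with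
  | one => exact ⟨[], fun q => rfl⟩
  | swap_mul f x y _ ih =>
    obtain ⟨l, hl⟩ := ih
    refine ⟨(e x, e y) :: l, fun q => ?_⟩
    have : swapsPerm ((e x, e y) :: l) = Equiv.swap (e x) (e y) * swapsPerm l := by
      simp [swapsPerm]
    rw [this, Equiv.Perm.mul_apply, hl, Equiv.Perm.mul_apply, e.injective.swap_apply]

/-- A word outside a finitely generated subgroup is separated from it by a finite action. -/
theorem notMem_rawSubgroup_iff (gens : List (List (ℕ × Bool))) (w : List (ℕ × Bool)) :
    FreeGroup.mk w ∉ rawSubgroup gens ↔ ∃ T : ℕ × List (List (ℕ × ℕ)),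
      (∀ g ∈ gens, runTable T.2 T.1 g = T.1) ∧ runTable T.2 T.1 w ≠ T.1 := by
  constructor
  · intro hw
    -- The word `w` is made readable too, so that its final state shows that its coset is not the
    -- base coset.
    obtain ⟨Q, hQ, A, c, o, hA, -, hrun⟩ := exists_isSchreierPart gens (w :: gens)
      (List.subset_cons_self _ _)
    obtain ⟨φ, hφ⟩ := A.exists_action
    obtain ⟨k, ⟨e⟩⟩ := Finite.exists_equiv_fin Q
    let e' : Q ↪ ℕ := e.toEmbedding.trans Fin.valEmbedding
    choose l hl using fun i => exists_swaps e' (φ (FreeGroup.of i))⁻¹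
    -- The table must cover all letters that occur: a letter beyond its end acts trivially by
    -- default.
    obtain ⟨M, hM⟩ := Finset.exists_nat_subset_range
      ((w :: gens).flatten.map Prod.fst).toFinset
    let T := (List.range M).map l
    have hT : ∀ u ∈ w :: gens, ∀ q, runTable T (e' q) u = e' ((φ (FreeGroup.mk u))⁻¹ q) := by
      intro u hu
      have hu' : ∀ x ∈ u, x.1 < M := fun x hx => by
        have : x.1 ∈ ((w :: gens).flatten.map Prod.fst).toFinset := by
          rw [List.mem_toFinset]
          exact List.mem_map_of_mem (List.mem_flatten_of_mem hu hx)
        simpa using hM this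
      clear hu
      induction u with
      | nil =>
        intro q
        change e' q = _
        rw [← FreeGroup.one_eq_mk]
        simp
      | cons x u ih =>
        intro q
        obtain ⟨i, b⟩ := x
        have hi : T.getD i [] = l i := by
          have := hu' (i, b) (by simp)
          simp only at this
          simp [T, List.getD, this]
        have hx : (cond b (applySwaps (T.getD i []) (e' q))
            (applySwaps (T.getD i []).reverse (e' q))) =
            e' ((φ (FreeGroup.mk [(i, b)]))⁻¹ q) := by
          rw [hi, applySwaps_eq, applySwaps_eq, swapsPerm_reverse]
          cases b
          · have h1 : FreeGroup.mk [(i, false)] = (FreeGroup.of i)⁻¹ := rfl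
            rw [cond_false, Equiv.Perm.inv_eq_iff_eq, hl, h1, map_inv, inv_inv]
            simp
          · exact hl i q
        have : runTable T (e' q) ((i, b) :: u) =
            runTable T (cond b (applySwaps (T.getD i []) (e' q))
              (applySwaps (T.getD i []).reverse (e' q))) u := rfl
        rw [this, hx, ih fun x hx => hu' x (List.mem_cons_of_mem _ hx),
          ← List.singleton_append (l := u), ← FreeGroup.mul_mk, map_mul, mul_inv_rev,
          Equiv.Perm.mul_apply]
    have hkey : ∀ u ∈ w :: gens,
        runTable T (e' o) u = e' o ↔ FreeGroup.mk u ∈ rawSubgroup gens := by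
      intro u hu
      obtain ⟨q, hq⟩ := hrun u hu
      rw [hT u hu, e'.injective.eq_iff, hφ _ _ _ hq, ← hA.injective.eq_iff, hA.base,
        hA.run_base hq, QuotientGroup.eq, inv_inv, mul_one]
      rfl
    exact ⟨(e' o, T), fun g hg => (hkey g (List.mem_cons_of_mem _ hg)).2
      (Subgroup.subset_closure ⟨g, hg, rfl⟩), fun h => hw ((hkey w (List.mem_cons_self ..)).1 h)⟩
  · rintro ⟨⟨q, T⟩, hg, hw⟩ hmem
    apply hw
    let φ := FreeGroup.lift fun i => (swapsPerm (T.getD i []))⁻¹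
    have hle : rawSubgroup gens ≤ (MulAction.stabilizer (Equiv.Perm ℕ) q).comap φ := by
      rw [rawSubgroup, Subgroup.closure_le]
      rintro g ⟨u, hu, rfl⟩
      have := hg u hu
      rw [runTable_eq, Equiv.Perm.inv_eq_iff_eq] at this
      exact this.symm
    have : φ (FreeGroup.mk w) q = q := hle hmem
    rw [runTable_eq, Equiv.Perm.inv_eq_iff_eq]
    exact this.symm

/-- For a given `l` the right-hand side can be checked by free reduction, so membership becomes
semi-decidable. -/
theorem mem_rawSubgroup_iff (gens : List (List (ℕ × Bool))) (w : List (ℕ × Bool)) :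
    FreeGroup.mk w ∈ rawSubgroup gens ↔ ∃ l : List (List (ℕ × Bool)),
      (∀ v ∈ l, v ∈ gens ∨ FreeGroup.invRev v ∈ gens) ∧
        FreeGroup.reduce l.flatten = FreeGroup.reduce w := by
  constructor
  · suffices h : ∀ g ∈ rawSubgroup gens, ∃ l : List (List (ℕ × Bool)),
        (∀ v ∈ l, v ∈ gens ∨ FreeGroup.invRev v ∈ gens) ∧ FreeGroup.mk l.flatten = g by
      intro hw
      obtain ⟨l, h1, h2⟩ := h _ hw
      exact ⟨l, h1, FreeGroup.reduce.sound h2⟩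
    intro g hg
    induction hg using Subgroup.closure_induction with
    | mem g hg =>
      obtain ⟨u, hu, rfl⟩ := hg
      exact ⟨[u], by simp [hu], by simp⟩
    | one => exact ⟨[], by simp, rfl⟩
    | mul g h _ _ hg hh =>
      obtain ⟨l, h1, rfl⟩ := hg
      obtain ⟨l', h1', rfl⟩ := hh
      refine ⟨l ++ l', fun v hv => ?_, by rw [List.flatten_append, FreeGroup.mul_mk]⟩
      rcases List.mem_append.1 hv with hv | hv
      exacts [h1 v hv, h1' v hv]
    | inv g _ hg =>
      obtain ⟨l, h1, rfl⟩ := hg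
      refine ⟨(l.map FreeGroup.invRev).reverse, fun v hv => ?_, ?_⟩
      · rw [List.mem_reverse, List.mem_map] at hv
        obtain ⟨u, hu, rfl⟩ := hv
        rw [FreeGroup.invRev_invRev]
        exact (h1 u hu).symm
      · rw [FreeGroup.inv_mk]
        congr 1
        clear * -
        induction l with
        | nil => rfl
        | cons u l ih => simp [ih]
  · rintro ⟨l, h1, h2⟩
    rw [← FreeGroup.reduce.exact h2]
    clear h2
    induction l with
    | nil => exact one_mem _
    | cons u l ih =>
      rw [List.flatten_cons, ← FreeGroup.mul_mk]
      refine mul_mem ?_ (ih fun v hv => h1 v (List.mem_cons_of_mem _ hv))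
      rcases h1 u (List.mem_cons_self ..) with h | h
      · exact Subgroup.subset_closure ⟨u, h, rfl⟩
      · rw [← inv_mem_iff, FreeGroup.inv_mk]
        exact Subgroup.subset_closure ⟨_, h, rfl⟩

end Membership

/-! ### Closure properties of computable functions -/

section Computability

variable {α β σ : Type*} [Primcodable α] [Primcodable β] [Primcodable σ]

/-- The membership test comes from an unbounded search and is known only to be computable; list
operations are therefore needed for computable functions, and all reduce to this fold. -/
theorem Computable.list_foldl {f : α → List β} {g : α → σ} {h : α → σ × β → σ}
    (hf : Computable f) (hg : Computable g) (hh : Computable₂ h) :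
    Computable fun a => (f a).foldl (fun s b => h a (s, b)) (g a) := by
  have hstep : Computable₂ fun (a : α) (p : ℕ × σ) =>
      Option.casesOn (motive := fun _ => σ) ((f a)[p.1]?) p.2 fun b => h a (p.2, b) := by
    refine Computable.option_casesOn (f := fun q : α × ℕ × σ => q.2.2)
      (o := fun q : α × ℕ × σ => (f q.1)[q.2.1]?)
      (g := fun (q : α × ℕ × σ) b => h q.1 (q.2.2, b)) ?_ ?_ ?_
    · exact Computable.list_getElem?.comp (hf.comp .fst) (Computable.fst.comp .snd)
    · exact Computable.snd.comp .snd
    · exact hh.comp (Computable.fst.comp .fst)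
        (Computable.pair (Computable.snd.comp (Computable.snd.comp .fst)) .snd)
  refine (Computable.nat_rec (Computable.list_length.comp hf) hg hstep).of_eq fun a => ?_
  have key : ∀ i ≤ (f a).length, (Nat.rec (g a) (fun (i : ℕ) (s : σ) =>
      Option.casesOn (motive := fun _ => σ) ((f a)[i]?) s fun b => h a (s, b)) i : σ) =
      ((f a).take i).foldl (fun s b => h a (s, b)) (g a) := by
    intro i
    induction i with
    | zero => simp
    | succ i ih =>
      intro hi
      have hlt : i < (f a).length := hi
      simp only [ih hlt.le, List.getElem?_eq_getElem hlt, List.take_add_one, List.foldl_append,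
        Option.toList_some, List.foldl_cons, List.foldl_nil]
  simpa using key _ le_rfl

theorem Computable.list_filter {f : α → List β} {p : α → β → Bool} (hf : Computable f)
    (hp : Computable₂ p) : Computable fun a => (f a).filter (p a) := by
  have hstep : Computable₂ fun (a : α) (q : List β × β) =>
      _root_.cond (p a q.2) (q.1 ++ [q.2]) q.1 := by
    refine Computable.cond (c := fun r : α × List β × β => p r.1 r.2.2)
      (f := fun r : α × List β × β => r.2.1 ++ [r.2.2]) (g := fun r : α × List β × β => r.2.1)
      ?_ ?_ ?_
    · exact hp.comp .fst (Computable.snd.comp .snd)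
    · exact Computable.list_concat.comp (Computable.fst.comp .snd) (Computable.snd.comp .snd)
    · exact Computable.fst.comp .snd
  refine (Computable.list_foldl hf (Computable.const []) hstep).of_eq fun a => ?_
  suffices h : ∀ l l' : List β, l.foldl (fun s b => _root_.cond (p a b) (s ++ [b]) s) l' =
      l' ++ l.filter (p a) by simpa using h (f a) []
  intro l
  induction l with
  | nil => simp
  | cons b l ih =>
    intro l'
    rw [List.foldl_cons, ih]
    cases hb : p a b <;> simp [hb]

theorem Computable.list_all {f : α → List β} {p : α → β → Bool} (hf : Computable f)
    (hp : Computable₂ p) : Computable fun a => (f a).all (p a) := by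
  have hstep : Computable₂ fun (a : α) (q : Bool × β) => q.1 && p a q.2 :=
    Primrec.and.to_comp.comp (Computable.fst.comp .snd) (hp.comp .fst (Computable.snd.comp .snd))
  refine (Computable.list_foldl hf (Computable.const true) hstep).of_eq fun a => ?_
  suffices h : ∀ (l : List β) (b : Bool), l.foldl (fun s b => s && p a b) b =
      (b && l.all (p a)) by simpa using h (f a) true
  intro l
  induction l with
  | nil => simp
  | cons b l ih =>
    intro c
    rw [List.foldl_cons, ih, List.all_cons, Bool.and_assoc]

/-- Candidates are tried in the order of their codes; a number that decodes to nothing counts as a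
failure. -/
theorem REPred.exists_of_computable {R : α → β → Bool} (hR : Computable₂ R) :
    REPred fun a => ∃ b, R a b = true := by
  have h : Computable₂ fun (a : α) (m : ℕ) =>
      (((Encodable.decode m : Option β).map (R a)).getD false) := by
    refine Computable.option_getD (Computable.option_map (Computable.decode.comp .snd)
      (hR.comp (Computable.fst.comp .fst) .snd)) (Computable.const false)
  refine (Partrec.rfind h.partrec₂).dom_re.of_eq fun a => ?_
  rw [Nat.rfind_dom']
  constructor
  · rintro ⟨m, hm, -⟩
    rcases hd : (Encodable.decode m : Option β) with _ | b
    · simp [hd] at hm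
    · exact ⟨b, by simpa [hd] using hm⟩
  · rintro ⟨b, hb⟩
    exact ⟨Encodable.encode b, by simp [hb], by simp⟩

theorem Primrec.nat_pow : Primrec₂ ((· ^ ·) : ℕ → ℕ → ℕ) := by
  have : Primrec fun p : ℕ × ℕ => (Nat.rec 1 (fun _ r => r * p.1) p.2 : ℕ) :=
    Primrec.nat_rec' Primrec.snd (Primrec.const 1)
      (Primrec.nat_mul.comp (Primrec.snd.comp Primrec.snd) (Primrec.fst.comp Primrec.fst)).to₂
  refine this.of_eq fun p => ?_
  induction p.2 with
  | zero => rfl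
  | succ k ih => exact congrArg (· * p.1) ih

end Computability

/-! ### Decidability of membership in finitely generated subgroups -/

section FreeGroupWords

theorem FreeGroup.reduce_eq_foldr {α : Type*} [DecidableEq α] (w : List (α × Bool)) :
    FreeGroup.reduce w = w.foldr (fun x l =>
      if l.head? = some (x.1, !x.2) then l.tail else x :: l) [] := by
  induction w with
  | nil => rfl
  | cons x w ih =>
    rw [List.foldr_cons, ← ih, FreeGroup.reduce.cons]
    rcases FreeGroup.reduce w with _ | ⟨⟨c, d⟩, l⟩
    · simp
    · obtain ⟨a, b⟩ := x
      by_cases h : a = c ∧ b = !d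
      · obtain ⟨rfl, rfl⟩ := h
        simp
      · have h' : ¬ (c = a ∧ d = !b) := by
          rintro ⟨rfl, rfl⟩
          simp at h
        simp [h, h']

theorem primrec_reduce : Primrec (FreeGroup.reduce : List (ℕ × Bool) → List (ℕ × Bool)) := by
  have h : Primrec₂ fun (_ : List (ℕ × Bool)) (q : (ℕ × Bool) × List (ℕ × Bool)) =>
      if q.2.head? = some (q.1.1, !q.1.2) then q.2.tail else q.1 :: q.2 := by
    have h2 : Primrec fun r : List (ℕ × Bool) × (ℕ × Bool) × List (ℕ × Bool) => r.2.2 :=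
      Primrec.snd.comp .snd
    have h1 : Primrec fun r : List (ℕ × Bool) × (ℕ × Bool) × List (ℕ × Bool) => r.2.1 :=
      Primrec.fst.comp .snd
    exact Primrec.ite (Primrec.eq.comp (Primrec.list_head?.comp h2)
      (Primrec.option_some.comp (Primrec.pair (Primrec.fst.comp h1)
        (Primrec.not.comp (Primrec.snd.comp h1)))))
      (Primrec.list_tail.comp h2) (Primrec.list_cons.comp h1 h2)
  exact (Primrec.list_foldr .id (.const []) h).of_eq fun w =>
    (FreeGroup.reduce_eq_foldr w).symm

theorem primrec_invRev : Primrec (FreeGroup.invRev : List (ℕ × Bool) → List (ℕ × Bool)) :=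
  Primrec.list_reverse.comp <| Primrec.list_map .id <|
    Primrec.pair (Primrec.fst.comp .snd) (Primrec.not.comp (Primrec.snd.comp .snd))

theorem primrec_applySwaps : Primrec₂ applySwaps := by
  have h : Primrec₂ fun (_ : List (ℕ × ℕ) × ℕ) (r : (ℕ × ℕ) × ℕ) =>
      if r.2 = r.1.1 then r.1.2 else if r.2 = r.1.2 then r.1.1 else r.2 := by
    have h0 : Primrec fun s : (List (ℕ × ℕ) × ℕ) × (ℕ × ℕ) × ℕ => s.2.2 := Primrec.snd.comp .snd
    have h1 : Primrec fun s : (List (ℕ × ℕ) × ℕ) × (ℕ × ℕ) × ℕ => s.2.1.1 :=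
      Primrec.fst.comp (Primrec.fst.comp .snd)
    have h2 : Primrec fun s : (List (ℕ × ℕ) × ℕ) × (ℕ × ℕ) × ℕ => s.2.1.2 :=
      Primrec.snd.comp (Primrec.fst.comp .snd)
    exact Primrec.ite (Primrec.eq.comp h0 h1) h2 (Primrec.ite (Primrec.eq.comp h0 h2) h1 h0)
  exact Primrec.list_foldr .fst .snd h

theorem primrec_runTable :
    Primrec fun r : (ℕ × List (List (ℕ × ℕ))) × List (ℕ × Bool) => runTable r.1.2 r.1.1 r.2 := by
  have h : Primrec₂ fun (r : (ℕ × List (List (ℕ × ℕ))) × List (ℕ × Bool)) (s : ℕ × ℕ × Bool) =>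
      cond s.2.2 (applySwaps (r.1.2.getD s.2.1 []) s.1)
        (applySwaps (r.1.2.getD s.2.1 []).reverse s.1) := by
    have h0 : Primrec fun t : ((ℕ × List (List (ℕ × ℕ))) × List (ℕ × Bool)) × ℕ × ℕ × Bool =>
        t.1.1.2.getD t.2.2.1 [] :=
      (Primrec.list_getD []).comp (Primrec.snd.comp (Primrec.fst.comp .fst))
        (Primrec.fst.comp (Primrec.snd.comp .snd))
    have h1 : Primrec fun t : ((ℕ × List (List (ℕ × ℕ))) × List (ℕ × Bool)) × ℕ × ℕ × Bool =>
        t.2.1 := Primrec.fst.comp .snd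
    exact Primrec.cond (Primrec.snd.comp (Primrec.snd.comp .snd)) (primrec_applySwaps.comp h0 h1)
      (primrec_applySwaps.comp (Primrec.list_reverse.comp h0) h1)
  exact Primrec.list_foldl .snd (Primrec.fst.comp .fst) h

/-- The generalized word problem of free groups is decidable. -/
theorem exists_computable_mem_rawSubgroup :
    ∃ mem : List (List (ℕ × Bool)) × List (ℕ × Bool) → Bool, Computable mem ∧
      ∀ q, mem q = true ↔ FreeGroup.mk q.2 ∈ rawSubgroup q.1 := by
  have hpos : REPred fun q : List (List (ℕ × Bool)) × List (ℕ × Bool) =>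
      FreeGroup.mk q.2 ∈ rawSubgroup q.1 := by
    have hmem : Computable₂ fun (q : List (List (ℕ × Bool)) × List (ℕ × Bool))
        (v : List (ℕ × Bool)) => !(q.1.all fun g => !decide (g = v)) :=
      Primrec.not.to_comp.comp (Computable.list_all (Computable.fst.comp .fst)
        (Primrec.not.comp (Primrec.eq.decide.comp .snd (Primrec.snd.comp .fst))).to_comp)
    have hmem' : ∀ (q : List (List (ℕ × Bool)) × List (ℕ × Bool)) (v : List (ℕ × Bool)),
        (!(q.1.all fun g => !decide (g = v))) = decide (v ∈ q.1) := by
      intro q v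
      rw [Bool.eq_iff_iff]
      simp
    simp only [hmem'] at hmem
    have hR : Computable₂ fun (q : List (List (ℕ × Bool)) × List (ℕ × Bool))
        (l : List (List (ℕ × Bool))) =>
        (l.all fun v => decide (v ∈ q.1) || decide (FreeGroup.invRev v ∈ q.1)) &&
          decide (FreeGroup.reduce l.flatten = FreeGroup.reduce q.2) := by
      refine Primrec.and.to_comp.comp (Computable.list_all .snd ?_) ?_
      · exact Primrec.or.to_comp.comp (hmem.comp (Computable.fst.comp .fst) .snd)
          (hmem.comp (Computable.fst.comp .fst) (primrec_invRev.to_comp.comp .snd))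
      · exact (Primrec.eq.decide.comp (primrec_reduce.comp (Primrec.list_flatten.comp .snd))
          (primrec_reduce.comp (Primrec.snd.comp .fst))).to_comp
    refine (REPred.exists_of_computable hR).of_eq fun q => ?_
    rw [mem_rawSubgroup_iff]
    simp
  have hneg : REPred fun q : List (List (ℕ × Bool)) × List (ℕ × Bool) =>
      ¬ FreeGroup.mk q.2 ∈ rawSubgroup q.1 := by
    have hR : Computable₂ fun (q : List (List (ℕ × Bool)) × List (ℕ × Bool))
        (T : ℕ × List (List (ℕ × ℕ))) =>
        (q.1.all fun g => decide (runTable T.2 T.1 g = T.1)) &&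
          !decide (runTable T.2 T.1 q.2 = T.1) := by
      refine Primrec.and.to_comp.comp (Computable.list_all (Computable.fst.comp .fst) ?_) ?_
      · refine Primrec₂.to_comp (Primrec.eq.decide.comp (primrec_runTable.comp (Primrec.pair
          (Primrec.snd.comp .fst) .snd)) (Primrec.fst.comp (Primrec.snd.comp .fst)))
      · exact (Primrec.not.comp (Primrec.eq.decide.comp (primrec_runTable.comp (Primrec.pair
          .snd (Primrec.snd.comp .fst))) (Primrec.fst.comp .snd))).to_comp
    refine (REPred.exists_of_computable hR).of_eq fun q => ?_
    rw [notMem_rawSubgroup_iff]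
    simp
  -- Post's theorem: a predicate is decidable if it and its complement are semi-decidable.
  obtain ⟨f, hf, h⟩ := ComputablePred.computable_iff.1
    (ComputablePred.computable_iff_re_compl_re'.2 ⟨hpos, hneg⟩)
  exact ⟨f, hf, fun q => (Iff.of_eq (congrFun h q)).symm⟩

end FreeGroupWords

/-! ### Kleene's theorem: images of regular languages are rational -/

section Kleene

variable {β σ N : Type*} [Monoid N]

theorem Set.Finite.isRationalSubset {S : Set N} (hS : S.Finite) : IsRationalSubset S := by
  induction S, hS using Set.Finite.induction_on with
  | empty => exact .empty
  | insert _ _ ih => exact .union (.singleton _) ih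

theorem IsRationalSubset.iUnion {ι : Type*} [Finite ι] {S : ι → Set N}
    (h : ∀ i, IsRationalSubset (S i)) : IsRationalSubset (⋃ i, S i) := by
  have : ∀ t : Set ι, t.Finite → IsRationalSubset (⋃ i ∈ t, S i) := by
    intro t ht
    induction t, ht using Set.Finite.induction_on with
    | empty => simpa using IsRationalSubset.empty
    | insert _ _ ih =>
      rw [Set.biUnion_insert]
      exact .union (h _) ih
  simpa using this Set.univ Set.finite_univ

/-- The labels in a monoid of the nonempty paths of an automaton whose interior states belong to
a given set. -/
inductive NFA.PathThrough (M : NFA β σ) (f : β → N) (S : Set σ) : σ → N → σ → Prop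
  | single {p q x} : q ∈ M.step p x → NFA.PathThrough M f S p (f x) q
  | cons {p q r x m} : r ∈ M.step p x → r ∈ S → NFA.PathThrough M f S r m q →
      NFA.PathThrough M f S p (f x * m) q

namespace NFA.PathThrough

variable {M : NFA β σ} {f : β → N} {S T : Set σ}

theorem mono (hST : S ⊆ T) {p q m} (h : M.PathThrough f S p m q) : M.PathThrough f T p m q := by
  induction h with
  | single h => exact .single h
  | cons h hr _ ih => exact .cons h (hST hr) ih

theorem trans {p q r m m'} (h : M.PathThrough f S p m r) (hr : r ∈ S)
    (h' : M.PathThrough f S r m' q) : M.PathThrough f S p (m * m') q := by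
  induction h with
  | single h => exact .cons h hr h'
  | cons h hs _ ih =>
    rw [mul_assoc]
    exact .cons h hs (ih hr h')

/-- Kleene's recursion: a path visiting `r` inside is cut at its first and last such visits, and the
piece between them is a product of loops at `r` with interior in `S`. -/
theorem insert_iff {r p q : σ} {m : N} : M.PathThrough f (insert r S) p m q ↔
    m ∈ {m | M.PathThrough f S p m q} ∪ {m | M.PathThrough f S p m r} *
      (Submonoid.closure {m | M.PathThrough f S r m r} : Set N) *
      {m | M.PathThrough f S r m q} := by
  constructor
  · intro h
    induction h with
    | single h => exact .inl (.single h)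
    | @cons p q s x m h hs _ ih =>
      rcases hs with rfl | hs
      · refine .inr ?_
        have hx : f x ∈ {m | M.PathThrough f S p m s} := .single h
        rw [mul_assoc]
        refine Set.mul_mem_mul hx ?_
        rcases ih with ih | ih
        · exact Set.mem_mul.2 ⟨1, one_mem _, m, ih, one_mul m⟩
        · obtain ⟨y, hy, m₃, h₃, rfl⟩ := Set.mem_mul.1 ih
          obtain ⟨m₁, h₁, m₂, h₂, rfl⟩ := Set.mem_mul.1 hy
          exact Set.mul_mem_mul (mul_mem (Submonoid.subset_closure h₁) h₂) h₃
      · rcases ih with ih | ih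
        · exact .inl (.cons h hs ih)
        · obtain ⟨y, hy, m₃, h₃, rfl⟩ := Set.mem_mul.1 ih
          obtain ⟨m₁, h₁, m₂, h₂, rfl⟩ := Set.mem_mul.1 hy
          refine .inr ?_
          rw [← mul_assoc, ← mul_assoc]
          exact Set.mul_mem_mul (Set.mul_mem_mul (.cons h hs h₁) h₂) h₃
  · rintro (h | h)
    · exact h.mono (Set.subset_insert _ _)
    · obtain ⟨y, hy, m₃, h₃, rfl⟩ := Set.mem_mul.1 h
      obtain ⟨m₁, h₁, m₂, h₂, rfl⟩ := Set.mem_mul.1 hy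
      have key : ∀ t, M.PathThrough f (insert r S) r t q →
          M.PathThrough f (insert r S) r (m₂ * t) q := by
        clear h hy
        induction h₂ using Submonoid.closure_induction with
        | mem g hg =>
          exact fun t ht => trans (hg.mono (Set.subset_insert _ _)) (Set.mem_insert _ _) ht
        | one =>
          intro t ht
          rwa [one_mul]
        | mul g h _ _ hg hh =>
          intro t ht
          rw [mul_assoc]
          exact hg _ (hh t ht)
      rw [mul_assoc]
      exact trans (h₁.mono (Set.subset_insert _ _)) (Set.mem_insert _ _)
        (key _ (h₃.mono (Set.subset_insert _ _)))

theorem isRationalSubset [Finite β] (hS : S.Finite) (p q : σ) :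
    IsRationalSubset {m | M.PathThrough f S p m q} := by
  induction S, hS using Set.Finite.induction_on generalizing p q with
  | empty =>
    refine Set.Finite.isRationalSubset ((Set.finite_range f).subset ?_)
    rintro m (h | ⟨_, h, _⟩)
    · exact ⟨_, rfl⟩
    · exact h.elim
  | @insert r _ _ _ ih =>
    have := IsRationalSubset.union (ih p q) (.mul (.mul (ih p r) (.star (ih r r))) (ih r q))
    convert this using 1
    ext m
    exact insert_iff

theorem of_mem_evalFrom {p q : σ} {w : List β} (h : q ∈ M.evalFrom {p} w) :
    (w = [] ∧ p = q) ∨ M.PathThrough f Set.univ p (w.map f).prod q := by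
  induction w generalizing p with
  | nil => exact .inl ⟨rfl, by simpa [eq_comm] using h⟩
  | cons x w ih =>
    rw [NFA.evalFrom_cons, NFA.stepSet_singleton, NFA.mem_evalFrom_iff_exists] at h
    obtain ⟨r, hr, hq⟩ := h
    right
    rw [List.map_cons, List.prod_cons]
    rcases ih hq with ⟨rfl, rfl⟩ | h
    · simpa using single (f := f) hr
    · exact .cons hr trivial h

theorem exists_evalFrom {p q : σ} {m : N} (h : M.PathThrough f S p m q) :
    ∃ w : List β, (w.map f).prod = m ∧ q ∈ M.evalFrom {p} w := by
  induction h with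
  | @single p q x h => exact ⟨[x], by simp, by simpa using h⟩
  | @cons p q r x m h _ _ ih =>
    obtain ⟨w, rfl, hw⟩ := ih
    refine ⟨x :: w, by simp, ?_⟩
    rw [NFA.evalFrom_cons, NFA.stepSet_singleton, NFA.mem_evalFrom_iff_exists]
    exact ⟨r, h, hw⟩

end NFA.PathThrough

/-- The image in a monoid of the language of a finite automaton is rational. -/
theorem NFA.isRationalSubset_image [Finite β] [Finite σ] (M : NFA β σ) (f : β → N) :
    IsRationalSubset {m | ∃ w ∈ M.accepts, (w.map f).prod = m} := by
  classical
  have h : IsRationalSubset (⋃ p : M.start, ⋃ q : M.accept,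
      -- `PathThrough` only has nonempty paths; the singleton accounts for the empty word.
      ((if p.1 = q.1 then {1} else ∅) ∪ {m | M.PathThrough f Set.univ p.1 m q.1})) := by
    refine .iUnion fun p => .iUnion fun q => .union ?_
      (NFA.PathThrough.isRationalSubset Set.finite_univ _ _)
    split_ifs
    exacts [.singleton 1, .empty]
  convert h using 1
  ext m
  simp only [Set.mem_ofPred_eq, Set.mem_iUnion, Set.mem_union]
  constructor
  · rintro ⟨w, hw, rfl⟩
    obtain ⟨q, hq, hqw⟩ := NFA.mem_accepts.1 hw
    obtain ⟨p, hp, hpq⟩ := NFA.mem_evalFrom_iff_exists.1 hqw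
    refine ⟨⟨p, hp⟩, ⟨q, hq⟩, ?_⟩
    rcases NFA.PathThrough.of_mem_evalFrom (f := f) hpq with ⟨rfl, rfl⟩ | h
    · exact .inl (by simp)
    · exact .inr h
  · rintro ⟨⟨p, hp⟩, ⟨q, hq⟩, h⟩
    have key : ∃ w : List β, (w.map f).prod = m ∧ q ∈ M.evalFrom {p} w := by
      rcases h with h | h
      · split_ifs at h with hpq
        · refine ⟨[], by simpa [eq_comm] using h, ?_⟩
          simpa [eq_comm] using hpq
        · exact h.elim
      · exact h.exists_evalFrom
    obtain ⟨w, hw, hwq⟩ := key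
    exact ⟨w, NFA.mem_accepts.2 ⟨q, hq, NFA.mem_evalFrom_iff_exists.2 ⟨p, hp, hwq⟩⟩, hw⟩

end Kleene

/-! ### Passing from the alphabet on `n` letters to the natural numbers -/

section RawWords

/-- The word of numbers that a word over the alphabet on `n` letters is written as. -/
def rawWord {n : ℕ} (w : List (Fin n × Bool)) : List (ℕ × Bool) :=
  w.map fun x => ((x.1 : ℕ), x.2)

theorem mk_rawWord {n : ℕ} (w : List (Fin n × Bool)) :
    FreeGroup.mk (rawWord w) = FreeGroup.map Fin.val (FreeGroup.mk w) := rfl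

theorem rawSubgroup_rawWords {n : ℕ} (gens : List (List (Fin n × Bool))) :
    rawSubgroup (rawWords gens) = (generatedSubgroup gens).map (FreeGroup.map Fin.val) := by
  rw [rawSubgroup, generatedSubgroup, MonoidHom.map_closure]
  congr 1
  ext g
  constructor
  · rintro ⟨w, hw, rfl⟩
    obtain ⟨v, hv, rfl⟩ := List.mem_map.1 hw
    exact ⟨_, ⟨v, hv, rfl⟩, rfl⟩
  · rintro ⟨_, ⟨v, hv, rfl⟩, rfl⟩
    exact ⟨_, List.mem_map.2 ⟨v, hv, rfl⟩, rfl⟩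

/-- The free group of rank `n` embeds in the free group on `ℕ`, so one algorithm there serves all
ranks. -/
theorem mk_rawWord_mem_iff {n : ℕ} (gens : List (List (Fin n × Bool)))
    (w : List (Fin n × Bool)) :
    FreeGroup.mk (rawWord w) ∈ rawSubgroup (rawWords gens) ↔
      FreeGroup.mk w ∈ generatedSubgroup gens := by
  rw [rawSubgroup_rawWords, mk_rawWord]
  exact Subgroup.mem_map_iff_mem (FreeGroup.map_injective Fin.val_injective)

theorem prefixBound_rawWords {n : ℕ} (gens : List (List (Fin n × Bool))) :
    prefixBound (rawWords gens) = prefixBound gens := by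
  simp [prefixBound, rawWords, List.length_flatten, Function.comp_def]

/-- The junction of the two copies is the cyclic condition on the end letters; a single free
reduction thus tests everything. -/
theorem FreeGroup.isCyclicallyReduced_iff_isReduced_append_self {α : Type*}
    {w : List (α × Bool)} :
    FreeGroup.IsCyclicallyReduced w ↔ FreeGroup.IsReduced (w ++ w) := by
  simp only [FreeGroup.isCyclicallyReduced_iff, FreeGroup.IsReduced, List.isChain_append]
  tauto

theorem isReduced_rawWord {n : ℕ} {w : List (Fin n × Bool)} :
    FreeGroup.IsReduced (rawWord w) ↔ FreeGroup.IsReduced w := by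
  simp only [FreeGroup.IsReduced, rawWord, List.isChain_map, Fin.val_inj]

theorem generatedSubgroup_cons {n : ℕ} (w : List (Fin n × Bool))
    (gens : List (List (Fin n × Bool))) :
    generatedSubgroup (w :: gens) = generatedSubgroup gens ⊔ Subgroup.zpowers (FreeGroup.mk w) := by
  rw [Subgroup.zpowers_eq_closure, generatedSubgroup, generatedSubgroup, ← Subgroup.closure_union]
  congr 1
  ext g
  simp only [List.mem_cons, exists_eq_or_imp, Set.mem_union, Set.mem_singleton_iff]
  constructor
  · rintro (h | h)
    exacts [.inr h.symm, .inl h]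
  · rintro (h | h)
    exacts [.inr h, .inl h.symm]

/-- The power of a word. -/
def powWord {β : Type*} (w : List β) (k : ℕ) : List β := (List.range k).flatMap fun _ => w

theorem mk_powWord {α : Type*} (w : List (α × Bool)) (k : ℕ) :
    FreeGroup.mk (powWord w k) = FreeGroup.mk w ^ k := by
  rw [FreeGroup.pow_mk, powWord, List.flatMap_def, List.map_const', List.length_range]

theorem rawWord_powWord {n : ℕ} (w : List (Fin n × Bool)) (k : ℕ) :
    rawWord (powWord w k) = powWord (rawWord w) k := by
  simp [rawWord, powWord, List.map_flatMap]

end RawWords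

/-- Decides whether a word represents a cyclically reduced `⊕`-cocycle, given a decision procedure
for the membership in finitely generated subgroups. -/
def isCocycleWord (mem : List (List (ℕ × Bool)) × List (ℕ × Bool) → Bool) (n : ℕ)
    (gens : List (List (ℕ × Bool))) (w : List (ℕ × Bool)) : Bool :=
  decide (FreeGroup.reduce (w ++ w) = w ++ w) &&
    (((List.range n).all fun i => mem (w :: gens, [(i, true)])) &&
    (decide (w = []) || (List.range (prefixBound gens)).all fun k =>
      !mem (gens, powWord w (k + 1))))

/-- Generation is tested on the free generators after adjoining `w` to the subgroup. Finitely many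
powers suffice by `IsSchreierPart.forall_pow_notMem_iff`, as `prefixBound` bounds the size of some
Schreier part; that part itself is never computed. -/
theorem isCocycleWord_rawWord {mem : List (List (ℕ × Bool)) × List (ℕ × Bool) → Bool}
    (hmem : ∀ q, mem q = true ↔ FreeGroup.mk q.2 ∈ rawSubgroup q.1) {n : ℕ}
    (gens : List (List (Fin n × Bool))) (w : List (Fin n × Bool)) :
    isCocycleWord mem n (rawWords gens) (rawWord w) = true ↔
      w ∈ cocycleWords (generatedSubgroup gens) := by
  have hcyc : FreeGroup.reduce (rawWord w ++ rawWord w) = rawWord w ++ rawWord w ↔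
      FreeGroup.IsCyclicallyReduced w := by
    rw [← FreeGroup.isReduced_iff_reduce_eq, rawWord, ← List.map_append, ← rawWord,
      isReduced_rawWord, FreeGroup.isCyclicallyReduced_iff_isReduced_append_self]
  have htop : (∀ i < n, FreeGroup.mk [(i, true)] ∈ rawSubgroup (rawWord w :: rawWords gens)) ↔
      generatedSubgroup gens ⊔ Subgroup.zpowers (FreeGroup.mk w) = ⊤ := by
    rw [← generatedSubgroup_cons]
    have h1 : ∀ i : Fin n, FreeGroup.mk [((i : ℕ), true)] ∈
        rawSubgroup (rawWord w :: rawWords gens) ↔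
        FreeGroup.of i ∈ generatedSubgroup (w :: gens) :=
      fun i => mk_rawWord_mem_iff (w :: gens) [(i, true)]
    constructor
    · intro h
      rw [eq_top_iff, ← FreeGroup.closure_range_of, Subgroup.closure_le]
      rintro _ ⟨i, rfl⟩
      exact (h1 i).1 (h i i.2)
    · intro h i hi
      refine (h1 ⟨i, hi⟩).2 ?_
      rw [h]
      trivial
  simp only [isCocycleWord, Bool.and_eq_true, Bool.or_eq_true, decide_eq_true_eq, List.all_eq_true,
    List.mem_range, hmem, Bool.not_eq_true', ← Bool.not_eq_true, prefixBound_rawWords,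
    ← rawWord_powWord, mk_rawWord_mem_iff, mk_powWord, hcyc, htop]
  refine and_congr_right fun hw => and_congr_right fun _ => ?_
  rw [hw.inf_zpowers_eq_bot_iff]
  obtain ⟨Q, hQ, A, c, o, hA, hcard, -⟩ := exists_isSchreierPart gens gens (List.Subset.refl _)
  have h := hA.forall_pow_notMem_iff hw hcard
  rw [← generatedSubgroup] at h
  rw [h]
  have e : rawWord w = [] ↔ w = [] := List.map_eq_nil_iff
  rw [e]
  tauto

/-! ### The automaton of cocycles -/

section Automaton

/-- The letters of the involutive alphabet on `n` letters. -/
def letters (n : ℕ) : List (ℕ × Bool) :=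
  (List.range n).flatMap fun i => [(i, true), (i, false)]

/-- The words of length at most `N` over the involutive alphabet on `n` letters. -/
def shortWords (n N : ℕ) : List (List (ℕ × Bool)) :=
  Nat.rec [[]] (fun _ l => [] :: (letters n).flatMap fun x => l.map fun w => x :: w) N

theorem mem_letters {n : ℕ} {x : ℕ × Bool} :
    x ∈ letters n ↔ ∃ y : Fin n × Bool, ((y.1 : ℕ), y.2) = x := by
  obtain ⟨i, b⟩ := x
  simp only [letters, List.mem_flatMap, List.mem_range, List.mem_cons, Prod.mk.injEq,
    List.not_mem_nil, or_false, Prod.exists]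
  constructor
  · rintro ⟨j, hj, ⟨rfl, rfl⟩ | ⟨rfl, rfl⟩⟩
    exacts [⟨⟨i, hj⟩, true, rfl, rfl⟩, ⟨⟨i, hj⟩, false, rfl, rfl⟩]
  · rintro ⟨j, c, rfl, rfl⟩
    refine ⟨j, j.2, ?_⟩
    cases c <;> simp

theorem mem_shortWords {n N : ℕ} {v : List (ℕ × Bool)} :
    v ∈ shortWords n N ↔ ∃ w : List (Fin n × Bool), w.length ≤ N ∧ rawWord w = v := by
  induction N generalizing v with
  | zero =>
    simp only [Nat.le_zero, List.length_eq_zero_iff, exists_eq_left]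
    exact List.mem_singleton.trans eq_comm
  | succ N ih =>
    have : shortWords n (N + 1) =
      [] :: (letters n).flatMap fun x => (shortWords n N).map fun w => x :: w := rfl
    simp only [this, List.mem_cons, List.mem_flatMap, List.mem_map, ih, mem_letters]
    constructor
    · rintro (rfl | ⟨_, ⟨y, rfl⟩, _, ⟨w, hw, rfl⟩, rfl⟩)
      · exact ⟨[], by simp, rfl⟩
      · exact ⟨y :: w, by simpa using hw, rfl⟩
    · rintro ⟨w, hw, rfl⟩
      rcases w with _ | ⟨y, w⟩
      · exact .inl rfl
      · exact .inr ⟨_, ⟨y, rfl⟩, _, ⟨w, by simpa using hw, rfl⟩, rfl⟩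

/-- The automaton on the words in a list `W`: an arc labelled `x` leads from `u` to `v` if `D`
takes the same values on `uxz` and on `vz` for all `z` in `W`. -/
def quotientAutomaton (n : ℕ) (W : List (List (ℕ × Bool))) (D : List (ℕ × Bool) → Bool) :
    FiniteAutomaton where
  numStates := W.length
  initial := (List.range W.length).filter fun j => decide (W.getD j [] = [])
  final := (List.range W.length).filter fun j => D (W.getD j [])
  arcs := ((List.range W.length).flatMap fun j => (letters n).flatMap fun x =>
      (List.range W.length).map fun k => (j, x, k)).filter fun t =>
    W.all fun z => decide (D (W.getD t.1 [] ++ t.2.1 :: z) = D (W.getD t.2.2 [] ++ z))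

theorem quotientAutomaton_accepts {n N : ℕ} {L : Language (Fin n × Bool)}
    {D : List (ℕ × Bool) → Bool} (hD : ∀ w, D (rawWord w) = true ↔ w ∈ L)
    (hfin : (Set.range L.leftQuotient).Finite)
    (hN : Nat.card (Set.range L.leftQuotient) ^ 2 ≤ N) :
    ((quotientAutomaton n (shortWords n N) D).toNFA n).accepts = L := by
  set W := shortWords n N with hW
  have hget : ∀ s : Fin (quotientAutomaton n W D).numStates,
      ∃ w : List (Fin n × Bool), rawWord w = W.getD s [] := by
    intro s
    have hs : (s : ℕ) < W.length := s.2
    have : W.getD s [] ∈ W := by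
      simp [List.getD, hs]
    obtain ⟨w, -, hw⟩ := mem_shortWords.1 this
    exact ⟨w, hw⟩
  choose word hword using hget
  have hinj : Function.Injective (rawWord : List (Fin n × Bool) → _) :=
    List.map_injective_iff.2 fun x y h => by
      simpa [Prod.ext_iff, Fin.val_inj] using h
  have hD' : ∀ u v, D (rawWord u) = D (rawWord v) ↔ (u ∈ L ↔ v ∈ L) := fun u v => by
    rw [← hD, ← hD, ← Bool.eq_iff_iff]
  refine NFA.accepts_eq_of_shortWords _ word N hfin hN ?_ ?_ ?_ ?_
  · intro w hw
    obtain ⟨j, hj, hjw⟩ := List.getElem_of_mem (mem_shortWords.2 ⟨w, hw, rfl⟩)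
    refine ⟨⟨j, hj⟩, hinj ((hword _).trans ?_)⟩
    rw [← hjw]
    simp [List.getD, hW, hj]
  · intro s
    have h1 : word s = [] ↔ W.getD s [] = [] := by
      rw [← hword, rawWord, List.map_eq_nil_iff]
    rw [h1]
    change (s : ℕ) ∈ List.filter _ _ ↔ _
    rw [List.mem_filter, List.mem_range, decide_eq_true_eq]
    exact and_iff_right s.2
  · intro s
    rw [← hD, hword]
    change (s : ℕ) ∈ List.filter _ _ ↔ _
    rw [List.mem_filter, List.mem_range]
    exact and_iff_right s.2
  · intro s x t
    change ((s : ℕ), ((x.1 : ℕ), x.2), (t : ℕ)) ∈ List.filter _ _ ↔ _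
    rw [List.mem_filter, List.all_eq_true]
    have hmem : ((s : ℕ), ((x.1 : ℕ), x.2), (t : ℕ)) ∈ ((List.range W.length).flatMap fun j =>
        (letters n).flatMap fun x => (List.range W.length).map fun k => (j, x, k)) := by
      simp only [List.mem_flatMap, List.mem_map, List.mem_range]
      exact ⟨s, s.2, _, mem_letters.2 ⟨x, rfl⟩, t, t.2, rfl⟩
    rw [and_iff_right hmem]
    constructor
    · intro h z hz
      have := h (rawWord z) (mem_shortWords.2 ⟨z, hz, rfl⟩)
      simp only [decide_eq_true_eq, ← hword] at this
      rw [← hD']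
      simpa [rawWord] using this
    · intro h v hv
      obtain ⟨z, hz, rfl⟩ := mem_shortWords.1 hv
      have := h z hz
      rw [← hD'] at this
      simp only [decide_eq_true_eq, ← hword]
      simpa [rawWord] using this

/-- The automaton that recognizes the cyclically reduced `⊕`-cocycles of a finitely generated
subgroup. -/
def cocycleAutomaton (mem : List (List (ℕ × Bool)) × List (ℕ × Bool) → Bool) (n : ℕ)
    (gens : List (List (ℕ × Bool))) : FiniteAutomaton :=
  quotientAutomaton n (shortWords n (quotientBound n (prefixBound gens) ^ 2))
    (isCocycleWord mem n gens)

theorem cocycleAutomaton_accepts {mem : List (List (ℕ × Bool)) × List (ℕ × Bool) → Bool}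
    (hmem : ∀ q, mem q = true ↔ FreeGroup.mk q.2 ∈ rawSubgroup q.1) {n : ℕ}
    (gens : List (List (Fin n × Bool))) :
    ((cocycleAutomaton mem n (rawWords gens)).toNFA n).accepts =
      cocycleWords (generatedSubgroup gens) := by
  obtain ⟨h1, h2⟩ := card_leftQuotient_cocycleWords_le gens
  refine quotientAutomaton_accepts (isCocycleWord_rawWord hmem gens) h1 ?_
  rw [prefixBound_rawWords]
  exact Nat.pow_le_pow_left h2 2

end Automaton

/-! ### Computability of the automaton -/

section AutomatonComputability

theorem primrec_prefixBound :
    Primrec (prefixBound : List (List (ℕ × Bool)) → ℕ) :=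
  Primrec.nat_add.comp (.const 1) (Primrec.nat_add.comp Primrec.list_length
    (Primrec.list_length.comp Primrec.list_flatten))

theorem primrec_quotientBound : Primrec₂ quotientBound := by
  have hn : Primrec fun p : ℕ × ℕ => p.1 * 2 + 1 :=
    Primrec.succ.comp (Primrec.nat_mul.comp .fst (.const 2))
  have hK : Primrec fun p : ℕ × ℕ => (p.2 + 1) ^ p.2 * 2 ^ p.2 :=
    Primrec.nat_mul.comp (Primrec.nat_pow.comp (Primrec.succ.comp .snd) .snd)
      (Primrec.nat_pow.comp (.const 2) .snd)
  exact Primrec.nat_mul.comp (.const 2) (Primrec.nat_mul.comp hn (Primrec.nat_mul.comp hn hK))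

theorem primrec_letters : Primrec letters :=
  Primrec.list_flatMap Primrec.list_range <| Primrec.list_cons.comp
    (Primrec.pair .snd (.const true)) <| Primrec.list_cons.comp
    (Primrec.pair .snd (.const false)) (.const [])

theorem primrec_shortWords : Primrec₂ shortWords := by
  have h : Primrec₂ fun (p : ℕ × ℕ) (q : ℕ × List (List (ℕ × Bool))) =>
      [] :: (letters p.1).flatMap fun x => q.2.map fun w => x :: w := by
    refine Primrec.list_cons.comp (.const []) (Primrec.list_flatMap
      (primrec_letters.comp (Primrec.fst.comp .fst)) ?_)
    exact Primrec.list_map (Primrec.snd.comp (Primrec.snd.comp .fst))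
      (Primrec.list_cons.comp (Primrec.snd.comp .fst) .snd)
  exact Primrec.nat_rec' .snd (.const [[]]) h

theorem primrec_powWord : Primrec₂ (powWord : List (ℕ × Bool) → ℕ → List (ℕ × Bool)) :=
  Primrec.list_flatMap (Primrec.list_range.comp .snd) (Primrec.fst.comp .fst)

theorem computable_isCocycleWord {mem : List (List (ℕ × Bool)) × List (ℕ × Bool) → Bool}
    (hmem : Computable mem) :
    Computable fun r : (ℕ × List (List (ℕ × Bool))) × List (ℕ × Bool) =>
      isCocycleWord mem r.1.1 r.1.2 r.2 := by
  have hcyc : Computable fun r : (ℕ × List (List (ℕ × Bool))) × List (ℕ × Bool) =>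
      decide (FreeGroup.reduce (r.2 ++ r.2) = r.2 ++ r.2) :=
    (Primrec.eq.decide.comp (primrec_reduce.comp (Primrec.list_append.comp .snd .snd))
      (Primrec.list_append.comp .snd .snd)).to_comp
  have htop : Computable fun r : (ℕ × List (List (ℕ × Bool))) × List (ℕ × Bool) =>
      (List.range r.1.1).all fun i => mem (r.2 :: r.1.2, [(i, true)]) := by
    refine Computable.list_all (Primrec.list_range.to_comp.comp (Computable.fst.comp .fst)) ?_
    exact hmem.comp (Primrec.pair (Primrec.list_cons.comp (Primrec.snd.comp .fst)
      (Primrec.snd.comp (Primrec.fst.comp .fst))) (Primrec.list_cons.comp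
        (Primrec.pair .snd (.const true)) (.const []))).to_comp
  have hpow : Computable fun r : (ℕ × List (List (ℕ × Bool))) × List (ℕ × Bool) =>
      (List.range (prefixBound r.1.2)).all fun k => !mem (r.1.2, powWord r.2 (k + 1)) := by
    refine Computable.list_all (Primrec.list_range.comp
      (primrec_prefixBound.comp (Primrec.snd.comp .fst))).to_comp ?_
    exact Primrec.not.to_comp.comp (hmem.comp (Primrec.pair (Primrec.snd.comp
      (Primrec.fst.comp .fst)) (primrec_powWord.comp (Primrec.snd.comp .fst)
        (Primrec.succ.comp .snd))).to_comp)
  have hnil : Computable fun r : (ℕ × List (List (ℕ × Bool))) × List (ℕ × Bool) =>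
      decide (r.2 = []) := (Primrec.eq.decide.comp .snd (.const [])).to_comp
  exact Primrec.and.to_comp.comp hcyc (Primrec.and.to_comp.comp htop
    (Primrec.or.to_comp.comp hnil hpow))

theorem computable_quotientAutomaton {α : Type*} [Primcodable α] {n : α → ℕ}
    {W : α → List (List (ℕ × Bool))} {D : α → List (ℕ × Bool) → Bool} (hn : Primrec n)
    (hW : Primrec W) (hD : Computable₂ D) :
    Computable fun a => quotientAutomaton (n a) (W a) (D a) := by
  have hlen : Primrec fun a => (W a).length := Primrec.list_length.comp hW
  have hrange : Primrec fun a => List.range (W a).length := Primrec.list_range.comp hlen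
  have hinit : Computable fun a =>
      (List.range (W a).length).filter fun j => decide ((W a).getD j [] = []) := by
    refine Computable.list_filter hrange.to_comp ?_
    exact (Primrec.eq.decide.comp ((Primrec.list_getD []).comp (hW.comp .fst) .snd)
      (.const [])).to_comp
  have hfinal : Computable fun a =>
      (List.range (W a).length).filter fun j => D a ((W a).getD j []) := by
    refine Computable.list_filter hrange.to_comp ?_
    exact hD.comp .fst ((Primrec.list_getD []).comp (hW.comp .fst) .snd).to_comp
  have hcand : Primrec fun a => (List.range (W a).length).flatMap fun j =>
      (letters (n a)).flatMap fun x => (List.range (W a).length).map fun k => (j, x, k) := by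
    refine Primrec.list_flatMap hrange (Primrec.list_flatMap
      (primrec_letters.comp (hn.comp .fst)) ?_)
    exact Primrec.list_map (hrange.comp (Primrec.fst.comp .fst)) (Primrec.pair
      (Primrec.snd.comp (Primrec.fst.comp .fst)) (Primrec.pair (Primrec.snd.comp .fst) .snd))
  have harcs : Computable fun a => ((List.range (W a).length).flatMap fun j =>
      (letters (n a)).flatMap fun x => (List.range (W a).length).map fun k => (j, x, k)).filter
      fun t => (W a).all fun z =>
        decide (D a ((W a).getD t.1 [] ++ t.2.1 :: z) = D a ((W a).getD t.2.2 [] ++ z)) := by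
    refine Computable.list_filter hcand.to_comp (Computable.list_all (hW.to_comp.comp .fst) ?_)
    have hW' : Primrec fun r : (α × ℕ × (ℕ × Bool) × ℕ) × List (ℕ × Bool) => W r.1.1 :=
      hW.comp (Primrec.fst.comp .fst)
    have ht : Primrec fun r : (α × ℕ × (ℕ × Bool) × ℕ) × List (ℕ × Bool) => r.1.2 :=
      Primrec.snd.comp .fst
    have hl : Primrec fun r : (α × ℕ × (ℕ × Bool) × ℕ) × List (ℕ × Bool) =>
        (W r.1.1).getD r.1.2.1 [] ++ r.1.2.2.1 :: r.2 :=
      Primrec.list_append.comp ((Primrec.list_getD []).comp hW' (Primrec.fst.comp ht))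
        (Primrec.list_cons.comp (Primrec.fst.comp (Primrec.snd.comp ht)) .snd)
    have hr : Primrec fun r : (α × ℕ × (ℕ × Bool) × ℕ) × List (ℕ × Bool) =>
        (W r.1.1).getD r.1.2.2.2 [] ++ r.2 :=
      Primrec.list_append.comp ((Primrec.list_getD []).comp hW'
        (Primrec.snd.comp (Primrec.snd.comp ht))) .snd
    exact Primrec.eq.decide.to_comp.comp
      (hD.comp (Computable.fst.comp .fst) hl.to_comp)
      (hD.comp (Computable.fst.comp .fst) hr.to_comp)
  have h := (Primrec.of_equiv_symm (e := FiniteAutomaton.equivTuple)).to_comp.comp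
    (Computable.pair hlen.to_comp (Computable.pair hinit (Computable.pair hfinal harcs)))
  exact h

theorem computable_cocycleAutomaton {mem : List (List (ℕ × Bool)) × List (ℕ × Bool) → Bool}
    (hmem : Computable mem) : Computable₂ (cocycleAutomaton mem) := by
  refine computable_quotientAutomaton (α := ℕ × List (List (ℕ × Bool))) Primrec.fst ?_
    (computable_isCocycleWord hmem)
  exact primrec_shortWords.comp .fst (Primrec.nat_pow.comp (primrec_quotientBound.comp .fst
    (primrec_prefixBound.comp .snd)) (.const 2))

end AutomatonComputability

/-! ### The main theorem -/

theorem exists_generatedSubgroup_eq {n : ℕ} {H : Subgroup (FreeGroup (Fin n))} (hH : H.FG) :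
    ∃ gens : List (List (Fin n × Bool)), generatedSubgroup gens = H := by
  obtain ⟨S, hS⟩ := hH
  refine ⟨S.toList.map FreeGroup.toWord, ?_⟩
  rw [← hS, generatedSubgroup]
  congr 1
  ext g
  simp [FreeGroup.mk_toWord]

theorem FreeGroup.mk_eq_prod {α : Type*} (w : List (α × Bool)) :
    FreeGroup.mk w = (w.map fun x => FreeGroup.mk [x]).prod := by
  induction w with
  | nil => rfl
  | cons x w ih =>
    rw [List.map_cons, List.prod_cons, ← ih, FreeGroup.mul_mk, List.singleton_append]

theorem mainTheorem5 :
    (∀ (n : ℕ) (H : Subgroup (FreeGroup (Fin n))), H.FG →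
      IsRationalSubset (directCocycles H ∩ cyclicallyReducedElements n)) ∧
    ∃ f : ℕ → List (List (ℕ × Bool)) → FiniteAutomaton, Computable₂ f ∧
      ∀ (n : ℕ) (gens : List (List (Fin n × Bool))) (w : List (Fin n × Bool)),
        w ∈ ((f n (rawWords gens)).toNFA n).accepts ↔
          ∃ u ∈ directCocycles (generatedSubgroup gens) ∩ cyclicallyReducedElements n,
            u.toWord = w := by
  obtain ⟨mem, hcomp, hmem⟩ := exists_computable_mem_rawSubgroup
  refine ⟨fun n H hH => ?_, cocycleAutomaton mem, computable_cocycleAutomaton hcomp,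
    fun n gens w => ?_⟩
  · obtain ⟨gens, rfl⟩ := exists_generatedSubgroup_eq hH
    -- Rationality is read off from the same automaton, each letter being sent to the group element
    -- that it represents.
    have h := NFA.isRationalSubset_image ((cocycleAutomaton mem n (rawWords gens)).toNFA n)
      fun x => FreeGroup.mk [x]
    rw [cocycleAutomaton_accepts hmem gens] at h
    convert h using 1
    ext u
    simp only [← FreeGroup.mk_eq_prod, mem_cocycleWords_iff_exists_toWord]
    constructor
    · exact fun hu => ⟨_, ⟨u, hu, rfl⟩, FreeGroup.mk_toWord⟩
    · rintro ⟨_, ⟨v, hv, rfl⟩, rfl⟩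
      rwa [FreeGroup.mk_toWord]
  · rw [cocycleAutomaton_accepts hmem gens, mem_cocycleWords_iff_exists_toWord]
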